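/- **Theorem 1.3 (Bilinear Strichartz estimate).** For $\lambda\ge 1$ let $\mathbb{T}_\lambda=\mathbb{R}/(\lambda\mathbb{Z})$, and let $\square=\partial_{x_1}^2-\partial_{x_2}^2$ on $\mathbb{R}\times\mathbb{T}_\lambda$, so that $e^{it\square}$ is the unitary group on $L^2(\mathbb{R}\times\mathbb{T}_\lambda)$ given by the Fourier multiplier $e^{-4\pi^2 it(\xi_1^2-\xi_2^2)}$, $\xi\in\mathbb{R}\times\frac1\lambda\mathbb{Z}$. Fix Littlewood–Paley cutoffs: bounded measurable functions $\chi,\psi:\mathbb{R}^2\to\mathbb{C}$ with $\chi(\xi)=0$ unless $|\xi|\le R$ and $\psi(\xi)=0$ unless $r\le|\xi|\le R$, where $r>0$. For integers $N\ge1$ let $P_N$ be the Fourier multiplier on $L^2(\mathbb{R}\times\mathbb{T}_\lambda)$ with symbol $\psi(\xi/N)$ if $N\ge2$ and $\chi(\xi)$ if $N=1$ (the choice $\chi=\psi$ is allowed). There are constants $K$ and $C$, depending only on the cutoffs, such that for all real $\lambda\ge1$, all integers $N_2\ge1$ and $N_1\ge K N_2$, and all $\phi_1,\phi_2\in L^2(\mathbb{R}\times\mathbb{T}_\lambda)$,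 $$\big\|e^{it\square}P_{N_1}\phi_1\cdot e^{it\square}P_{N_2}\phi_2\big\|_{L^2_{t,x}([0,1]\times\mathbb{R}\times\mathbb{T}_\lambda)}\le C\Big(\frac1\lambda+\frac{N_2}{N_1}\Big)^{1/2}\|\phi_1\|_{L^2}\|\phi_2\|_{L^2}.$$ -/

import Mathlib

open MeasureTheory
open scoped FourierTransform ENNReal

noncomputable section

/-- The space `L²(ℝ × 𝕋_L)`, where `𝕋_L = ℝ / Lℤ` carries the measure induced by Lebesgue measure
(of total mass `L`) and `ℝ × 𝕋_L` carries the product measure. -/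
abbrev L2Cyl (L : ℝ) [Fact (0 < L)] : Type :=
  Lp ℂ 2 (volume : Measure (ℝ × AddCircle L))

/-- A bounded measurable function on the frequency plane `ℝ²`. -/
structure FourierSymbol where
  toFun : ℝ → ℝ → ℂ
  measurable : Measurable (fun ξ : ℝ × ℝ => toFun ξ.1 ξ.2)
  bounded : ∃ B : ℝ, ∀ ξ₁ ξ₂ : ℝ, ‖toFun ξ₁ ξ₂‖ ≤ B

theorem memLp_mode (L : ℝ) [Fact (0 < L)] (k : ℤ) (f : Lp ℂ 2 (volume : Measure ℝ)) :
    MemLp (fun x : ℝ × AddCircle L => fourier k x.2 * f x.1) 2 volume := by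
  have h1 : MemLp (fun x : ℝ × AddCircle L => f x.1) 2 volume :=
    (Lp.memLp f).comp_fst (volume : Measure (AddCircle L))
  refine h1.of_le (((fourier k).continuous.measurable.comp measurable_snd).aestronglyMeasurable.mul
    h1.1) (Filter.Eventually.of_forall fun x => ?_)
  rw [norm_mul, fourier_apply, Circle.norm_coe, one_mul]

/-- The function `(x₁, x₂) ↦ e^{2πi k x₂ / L} f(x₁)` of `L²(ℝ × 𝕋_L)`. -/
def mode (L : ℝ) [Fact (0 < L)] (k : ℤ) (f : Lp ℂ 2 (volume : Measure ℝ)) : L2Cyl L :=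
  (memLp_mode L k f).toLp _

theorem memLp_circleCoeff (L : ℝ) [Fact (0 < L)] (k : ℤ) (φ : L2Cyl L) :
    MemLp (fun x₁ : ℝ => (1 / L : ℂ) * ∫ x₂ : AddCircle L, fourier (-k) x₂ * φ (x₁, x₂))
      2 volume := by
  refine MemLp.const_mul ?_ _
  have hm : AEStronglyMeasurable
      (fun x : ℝ × AddCircle L => fourier (-k) x.2 * φ x)
      ((volume : Measure ℝ).prod (volume : Measure (AddCircle L))) :=
    ((fourier (-k)).continuous.measurable.comp measurable_snd).aestronglyMeasurable.mul
      (Lp.aestronglyMeasurable φ)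
  refine ⟨hm.integral_prod_right', ?_⟩
  rw [eLpNorm_lt_top_iff_lintegral_rpow_enorm_lt_top (by norm_num) (by norm_num)]
  have hφ := (eLpNorm_lt_top_iff_lintegral_rpow_enorm_lt_top (by norm_num) (by norm_num)).1
    (Lp.memLp φ).2
  have hφm : AEMeasurable (fun x : ℝ × AddCircle L => ‖φ x‖ₑ ^ (2 : ℝ))
      ((volume : Measure ℝ).prod (volume : Measure (AddCircle L))) :=
    (Lp.aestronglyMeasurable φ).enorm.pow_const _
  simp only [ENNReal.toReal_ofNat] at hφ ⊢
  replace hφ : ∫⁻ x₁ : ℝ, ∫⁻ x₂ : AddCircle L, ‖φ (x₁, x₂)‖ₑ ^ (2 : ℝ) < ∞ :=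
    (lintegral_prod _ hφm).symm.trans_lt hφ
  have key : ∀ᵐ x₁ : ℝ, ‖∫ x₂ : AddCircle L, fourier (-k) x₂ * φ (x₁, x₂)‖ₑ ^ (2 : ℝ) ≤
      ENNReal.ofReal L * ∫⁻ x₂ : AddCircle L, ‖φ (x₁, x₂)‖ₑ ^ (2 : ℝ) := by
    have hs := (Lp.aestronglyMeasurable φ).prodMk_left
    filter_upwards [hs] with x₁ hx
    have h1 : ‖∫ x₂ : AddCircle L, fourier (-k) x₂ * φ (x₁, x₂)‖ₑ ≤
        ∫⁻ x₂ : AddCircle L, ‖φ (x₁, x₂)‖ₑ := by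
      refine (enorm_integral_le_lintegral_enorm _).trans (le_of_eq ?_)
      congr 1
      ext x₂
      rw [← ofReal_norm, norm_mul, fourier_apply, Circle.norm_coe, one_mul, ofReal_norm]
    have h2 := ENNReal.lintegral_mul_le_Lp_mul_Lq (volume : Measure (AddCircle L))
      Real.HolderConjugate.two_two hx.enorm (aemeasurable_const (b := (1 : ℝ≥0∞)))
    simp only [Pi.mul_apply, mul_one, ENNReal.one_rpow, lintegral_one,
      AddCircle.measure_univ] at h2
    calc _ ≤ (_ : ℝ≥0∞) ^ (2 : ℝ) := ENNReal.rpow_le_rpow (h1.trans h2) (by norm_num)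
      _ = _ := by
        rw [ENNReal.mul_rpow_of_nonneg _ _ (by norm_num), ← ENNReal.rpow_mul,
          ← ENNReal.rpow_mul, mul_comm]
        norm_num
  refine (lintegral_mono_ae key).trans_lt ?_
  rw [lintegral_const_mul' _ _ ENNReal.ofReal_ne_top]
  exact ENNReal.mul_lt_top ENNReal.ofReal_lt_top hφ

/-- The `k`-th Fourier coefficient in the periodic variable,
`φ_k(x₁) = (1/L) ∫_{𝕋_L} e^{-2πi k x₂ / L} φ(x₁, x₂) dx₂`, an element of `L²(ℝ)`. -/
def circleCoeff (L : ℝ) [Fact (0 < L)] (k : ℤ) (φ : L2Cyl L) : Lp ℂ 2 (volume : Measure ℝ) :=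
  (memLp_circleCoeff L k φ).toLp _

theorem memLp_symbolMul (m : FourierSymbol) (ξ₂ : ℝ) (g : Lp ℂ 2 (volume : Measure ℝ)) :
    MemLp (fun ξ₁ : ℝ => m.toFun ξ₁ ξ₂ * g ξ₁) 2 volume := by
  obtain ⟨B, hB⟩ := m.bounded
  refine (Lp.memLp g).of_le_mul (c := B) (AEStronglyMeasurable.mul ?_ (Lp.aestronglyMeasurable g))
    (Filter.Eventually.of_forall fun x => ?_)
  · exact (m.measurable.comp (measurable_id.prodMk measurable_const)).aestronglyMeasurable
  · rw [norm_mul]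
    exact mul_le_mul_of_nonneg_right (hB _ _) (norm_nonneg _)

/-- Multiplication of `g ∈ L²(ℝ)` by `ξ₁ ↦ m(ξ₁, ξ₂)`, for a fixed `ξ₂`. -/
def symbolMul (m : FourierSymbol) (ξ₂ : ℝ) (g : Lp ℂ 2 (volume : Measure ℝ)) :
    Lp ℂ 2 (volume : Measure ℝ) :=
  (memLp_symbolMul m ξ₂ g).toLp _

/-- The Fourier multiplier operator on `L²(ℝ × 𝕋_L)` with symbol `m`, that is, the operator whose
effect on the Fourier side is `φ̂(ξ) ↦ m(ξ) φ̂(ξ)`, `ξ ∈ ℝ × (1/L)ℤ`.  Here `𝓕` is the Fourier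
transform of `L²(ℝ)` with kernel `e^{-2πi x₁ ξ₁}`.  The sum over the frequencies `ξ₂ = k / L` is
a sum in `L²(ℝ × 𝕋_L)` of orthogonal functions with summable squared norms. -/
def fourierMultiplier (L : ℝ) [Fact (0 < L)] (m : FourierSymbol) (φ : L2Cyl L) : L2Cyl L :=
  ∑' k : ℤ, mode L k (𝓕⁻ (symbolMul m (k / L) (𝓕 (circleCoeff L k φ))))

/-- The symbol `e^{-4π² i t (ξ₁² - ξ₂²)}` of `e^{it□}`, `□ = ∂₁² - ∂₂²`. -/
def hyperbolicSymbol (t : ℝ) : FourierSymbol where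
  toFun ξ₁ ξ₂ := Complex.exp ((-(4 * Real.pi ^ 2 * t * (ξ₁ ^ 2 - ξ₂ ^ 2)) : ℝ) * Complex.I)
  measurable := by fun_prop
  bounded := ⟨1, fun ξ₁ ξ₂ => (Complex.norm_exp_ofReal_mul_I _).le⟩

/-- The unitary group `e^{it□}` on `L²(ℝ × 𝕋_L)`: `u(t) = e^{it□} φ` solves
`i ∂_t u + □ u = 0`, `u(0) = φ`. -/
def hyperbolicFlow (L : ℝ) [Fact (0 < L)] (t : ℝ) (φ : L2Cyl L) : L2Cyl L :=
  fourierMultiplier L (hyperbolicSymbol t) φ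

/-- The cutoff functions from which Littlewood-Paley projections are made: `shell` is supported in
an annulus `r ≤ |ξ| ≤ R` and is rescaled to the frequencies `|ξ| ∼ N` for `N ≥ 2`; `low` is
supported in the ball `|ξ| ≤ R` and is used for `N = 1`.  The inhomogeneous convention
(`P_1` keeps all low frequencies) and the homogeneous one (`low = shell`), smooth cutoffs and
sharp ones are all of this form. -/
structure LittlewoodPaleyCutoff where
  low : FourierSymbol
  shell : FourierSymbol
  r : ℝ
  R : ℝ
  r_pos : 0 < r
  low_support : ∀ ξ₁ ξ₂ : ℝ, low.toFun ξ₁ ξ₂ ≠ 0 → Real.sqrt (ξ₁ ^ 2 + ξ₂ ^ 2) ≤ R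
  shell_support : ∀ ξ₁ ξ₂ : ℝ, shell.toFun ξ₁ ξ₂ ≠ 0 →
    r ≤ Real.sqrt (ξ₁ ^ 2 + ξ₂ ^ 2) ∧ Real.sqrt (ξ₁ ^ 2 + ξ₂ ^ 2) ≤ R

/-- The symbol `ξ ↦ m(ξ / N)`. -/
def FourierSymbol.dilate (m : FourierSymbol) (N : ℕ) : FourierSymbol where
  toFun ξ₁ ξ₂ := m.toFun (ξ₁ / N) (ξ₂ / N)
  measurable := m.measurable.comp (f := fun ξ : ℝ × ℝ => (ξ.1 / (N : ℝ), ξ.2 / (N : ℝ)))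
    (by fun_prop)
  bounded := m.bounded.imp fun _ h ξ₁ ξ₂ => h (ξ₁ / N) (ξ₂ / N)

/-- The Littlewood-Paley projection `P_N` on `L²(ℝ × 𝕋_L)`. -/
def lpProj (ψ : LittlewoodPaleyCutoff) (L : ℝ) [Fact (0 < L)] (N : ℕ) (φ : L2Cyl L) : L2Cyl L :=
  fourierMultiplier L (if N = 1 then ψ.low else ψ.shell.dilate N) φ

/-- The norm of `L²_{t,x}([0,1] × ℝ × 𝕋_L)`, as the `L²` norm in `t ∈ [0,1]` of the `L²` norm in
`x`.  It depends only on the class of `F t` modulo null sets for each `t`. -/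
def spaceTimeL2Norm (L : ℝ) [Fact (0 < L)] (F : ℝ → ℝ × AddCircle L → ℂ) : ℝ≥0∞ :=
  (∫⁻ t in Set.Icc (0 : ℝ) 1, eLpNorm (F t) 2 volume ^ 2) ^ (1 / 2 : ℝ)

end

/-! Fix a frequency `(ξ, n / L)` of the product. The Fourier coefficient there is, as a function of
`t`, a superposition of waves indexed by the low frequency `(η, l / L)`, under the product of
counting and Lebesgue measure. Up to a constant and a factor `8π²`, the time frequency is `x² - z²`,
where `(x, z)` is the low frequency minus half of `(ξ, n / L)`. A `TT*` argument in time bounds its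
`L²([0,1])` norm squared by the `L²` norm squared of the integrand times the largest measure of a
unit window `|x² - z² - c| ≤ 1` in the allowed region (`lintegral_sq_oscillatory_le`,
`lintegral_exp_neg_resonance_le`).

The window is a neighbourhood of a hyperbola in a disc of radius `ρ ∼ N₂`. The gradient of `x² - z²`
has length `2|(x, z)|`, the distance between the two input frequencies, which is of order `M ∼ N₁`;
the indefinite sign costs nothing. The strip thus has thickness `1 / M` and length `ρ`, and lattice
density `L` gives `ρL / M`. Near `x = 0` a line `l = const` is tangent to the hyperbola and a single
slice can have length of order 1, which adds the term 1 (`tsum_volume_resonance_le`). The sum `1 +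
ρL / M = L (1 / L + ρ / M)` is the claimed gain, its factor `L` being absorbed by the normalisation
of Parseval on the circle.

Plancherel in space and Tonelli then sum over `(ξ, n)`, turning the convolution of squares into a
product of norms (`tsum_lintegral_sq_convIntegrand`). Compact frequency support makes all mode sums
finite and all Fourier transforms honest integrals. -/

/-! ### Measure of unit neighbourhoods of hyperbolas -/

/-- With `v` the larger of the two lower bounds for `x²`, the set lies in `[√v, √(v + 2)]`, of
length `2 / (√(v + 2) + √v)`. Keeping `a` in the bound serves both the steep case and the summation
over slices. -/
theorem volume_sq_near_le {a : ℝ} (ha : 0 ≤ a) (B : ℝ) :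
    volume {x : ℝ | a ≤ x ∧ |x ^ 2 - B| ≤ 1} ≤
      ENNReal.ofReal (2 / √(max (a ^ 2) (B - 1) + 2)) := by
  set v := max (a ^ 2) (B - 1) with hv
  have hv0 : 0 ≤ v := (sq_nonneg a).trans (le_max_left _ _)
  have hsub : {x : ℝ | a ≤ x ∧ |x ^ 2 - B| ≤ 1} ⊆ Set.Icc (√v) (√(v + 2)) := by
    rintro x ⟨hax, hx⟩
    obtain ⟨h1, h2⟩ := abs_le.1 hx
    have hx0 : 0 ≤ x := ha.trans hax
    refine ⟨Real.sqrt_le_iff.2 ⟨hx0, max_le ?_ (by linarith)⟩, Real.le_sqrt_of_sq_le ?_⟩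
    · exact pow_le_pow_left₀ ha hax 2
    · linarith [le_max_right (a ^ 2) (B - 1)]
  refine (measure_mono hsub).trans ?_
  rw [Real.volume_Icc]
  refine ENNReal.ofReal_le_ofReal ?_
  have hp : 0 < √(v + 2) := Real.sqrt_pos.2 (by linarith)
  have hs : 0 ≤ √v := Real.sqrt_nonneg v
  have e1 : √(v + 2) ^ 2 = v + 2 := Real.sq_sqrt (by linarith)
  have e2 : √v ^ 2 = v := Real.sq_sqrt hv0
  have hle : √v ≤ √(v + 2) := Real.sqrt_le_sqrt (by linarith)
  rw [le_div_iff₀ hp]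
  nlinarith

/-- Telescoping comparison of `∑ (s + j d)^{-1/2}` with its integral. -/
theorem sum_inv_sqrt_le {s d : ℝ} (hs : 1 ≤ s) (hd : 0 < d) (J : ℕ) :
    ∑ j ∈ Finset.range (J + 1), 1 / √(s + j * d) ≤ 1 + 2 / d * (√(s + J * d) - √s) := by
  induction J with
  | zero =>
    have : 1 ≤ √s := Real.one_le_sqrt.2 hs
    simpa using inv_le_one_of_one_le₀ this
  | succ J ih =>
    rw [Finset.sum_range_succ]
    have hJ : (0 : ℝ) ≤ J * d := by positivity
    have hp : 0 < √(s + (J + 1 : ℕ) * d) := Real.sqrt_pos.2 (by push_cast; nlinarith)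
    have e1 : √(s + (J + 1 : ℕ) * d) ^ 2 = s + J * d + d := by
      rw [Real.sq_sqrt (by push_cast; nlinarith)]; push_cast; ring
    have e2 : √(s + J * d) ^ 2 = s + J * d := Real.sq_sqrt (by linarith)
    have h0 : 0 ≤ √(s + J * d) := Real.sqrt_nonneg _
    have hle : √(s + J * d) ≤ √(s + (J + 1 : ℕ) * d) :=
      Real.sqrt_le_sqrt (by push_cast; linarith)
    -- The increment of the square root is `d` over the sum of the two roots, hence at least `d`
    -- over twice the larger.
    have key : 1 / √(s + (J + 1 : ℕ) * d) ≤
        2 / d * (√(s + (J + 1 : ℕ) * d) - √(s + J * d)) := by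
      rw [div_mul_eq_mul_div, div_le_div_iff₀ hp hd]
      nlinarith
    linarith

/-- A single slice may have length of order 1, but as `B l` grows at rate at least `d` the lengths
decay like `(s + j d / 2)^{-1/2}`. Summation gives a difference of square roots, so the bound does
not depend on the centre `p`. -/
theorem sum_volume_sq_near_le {A : Finset ℤ} {B : ℤ → ℝ} {d : ℝ} (hd : 0 < d)
    (hB : ∀ l ∈ A, ∀ l' ∈ A, l ≤ l' → d * ((l' : ℝ) - l) ≤ B l' - B l) (p : ℝ) {ρ : ℝ}
    (hρ : 0 ≤ ρ) :
    ∑ l ∈ A, volume {x : ℝ | 0 ≤ x ∧ |x - p| ≤ ρ ∧ |x ^ 2 - B l| ≤ 1} ≤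
      ENNReal.ofReal (4 * (1 + 4 / d * (2 * ρ + 2))) := by
  classical
  set a := max (p - ρ) 0 with ha
  have ha0 : 0 ≤ a := le_max_right _ _
  set E : ℤ → Set ℝ := fun l => {x : ℝ | 0 ≤ x ∧ |x - p| ≤ ρ ∧ |x ^ 2 - B l| ≤ 1} with hE
  have hmem : ∀ l, ∀ x ∈ E l, a ≤ x ∧ x ≤ a + 2 * ρ ∧ |x ^ 2 - B l| ≤ 1 := by
    rintro l x ⟨h0, hx, hx'⟩
    obtain ⟨h1, h2⟩ := abs_le.1 hx
    exact ⟨max_le (by linarith) h0, by linarith [le_max_left (p - ρ) 0], hx'⟩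
  set A' := A.filter (fun l => (E l).Nonempty) with hA'
  have hsum : ∑ l ∈ A, volume (E l) = ∑ l ∈ A', volume (E l) := by
    refine (Finset.sum_filter_of_ne fun l _ hl => ?_).symm
    by_contra h
    rw [Set.not_nonempty_iff_eq_empty] at h
    exact hl (by rw [h, measure_empty])
  have hBl : ∀ l ∈ A', a ^ 2 - 1 ≤ B l ∧ B l ≤ (a + 2 * ρ) ^ 2 + 1 := by
    intro l hl
    obtain ⟨x, hx⟩ := (Finset.mem_filter.1 hl).2
    obtain ⟨h1, h2, h3⟩ := hmem l x hx
    obtain ⟨h4, h5⟩ := abs_le.1 h3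
    have := pow_le_pow_left₀ ha0 h1 2
    have := pow_le_pow_left₀ (ha0.trans h1) h2 2
    constructor <;> linarith
  change ∑ l ∈ A, volume (E l) ≤ _
  rw [hsum]
  rcases A'.eq_empty_or_nonempty with hem | hne
  · simp [hem]
  set l₀ := A'.min' hne
  set l₁ := A'.max' hne
  have hl₀ : l₀ ∈ A' := A'.min'_mem hne
  have hl₁ : l₁ ∈ A' := A'.max'_mem hne
  have h01 : l₀ ≤ l₁ := A'.min'_le _ hl₁
  obtain ⟨J, hJ⟩ := Int.eq_ofNat_of_zero_le (sub_nonneg.2 h01)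
  have hsep : ∀ l ∈ A', d * ((l : ℝ) - l₀) ≤ B l - B l₀ := fun l hl =>
    hB _ (Finset.mem_filter.1 hl₀).1 _ (Finset.mem_filter.1 hl).1 (A'.min'_le _ hl)
  have hJd : (J : ℝ) * d ≤ (a + 2 * ρ) ^ 2 + 1 - (a ^ 2 - 1) := by
    have h1 := hsep l₁ hl₁
    have h2 : (l₁ : ℝ) - l₀ = J := by exact_mod_cast hJ
    rw [h2] at h1
    linarith [(hBl l₁ hl₁).2, (hBl l₀ hl₀).1]
  set s := 1 + a ^ 2 with hs
  have hterm : ∀ l ∈ A', volume (E l) ≤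
      ENNReal.ofReal (4 * (1 / √(s + (l - l₀).toNat * (d / 2)))) := by
    intro l hl
    have hcast : (((l - l₀).toNat : ℕ) : ℝ) = (l : ℝ) - l₀ := by
      have : (((l - l₀).toNat : ℕ) : ℤ) = l - l₀ :=
        Int.toNat_of_nonneg (sub_nonneg.2 (A'.min'_le _ hl))
      exact_mod_cast congrArg (Int.cast : ℤ → ℝ) this
    refine (measure_mono fun x hx => ?_).trans ((volume_sq_near_le ha0 (B l)).trans
      (ENNReal.ofReal_le_ofReal ?_))
    · exact ⟨(hmem l x hx).1, (hmem l x hx).2.2⟩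
    · rw [hcast]
      have h1 := hsep l hl
      have h2 := (hBl l₀ hl₀).1
      have h3 : (0 : ℝ) ≤ (l : ℝ) - l₀ := by
        rw [← hcast]; positivity
      -- The maximum is at least the average of its entries, and `B l ≥ a² - 1 + d (l - l₀)`;
      -- averaging is what halves `d`.
      have hv : s + ((l : ℝ) - l₀) * (d / 2) ≤ max (a ^ 2) (B l - 1) + 2 := by
        have := le_max_left (a ^ 2) (B l - 1)
        have := le_max_right (a ^ 2) (B l - 1)
        nlinarith
      have hpos : 0 < s + ((l : ℝ) - l₀) * (d / 2) := by positivity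
      have := Real.sqrt_le_sqrt hv
      have hp := Real.sqrt_pos.2 hpos
      rw [mul_one_div]
      gcongr
      norm_num
  calc ∑ l ∈ A', volume (E l)
      ≤ ∑ l ∈ A', ENNReal.ofReal (4 * (1 / √(s + (l - l₀).toNat * (d / 2)))) :=
        Finset.sum_le_sum hterm
    _ = ENNReal.ofReal (∑ l ∈ A', 4 * (1 / √(s + (l - l₀).toNat * (d / 2)))) :=
        (ENNReal.ofReal_sum_of_nonneg fun _ _ => by positivity).symm
    _ ≤ _ := ENNReal.ofReal_le_ofReal ?_
  have hinj : Set.InjOn (fun l : ℤ => (l - l₀).toNat) A' := by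
    intro l hl l' hl' h
    have := A'.min'_le _ hl
    have := A'.min'_le _ hl'
    simp only at h
    omega
  have hsub : A'.image (fun l : ℤ => (l - l₀).toNat) ⊆ Finset.range (J + 1) := by
    intro j hj
    obtain ⟨l, hl, rfl⟩ := Finset.mem_image.1 hj
    have := A'.le_max' _ hl
    simp only [Finset.mem_range]
    omega
  rw [← Finset.mul_sum]
  gcongr
  calc ∑ l ∈ A', 1 / √(s + (l - l₀).toNat * (d / 2))
      = ∑ j ∈ A'.image (fun l : ℤ => (l - l₀).toNat), 1 / √(s + j * (d / 2)) :=
        (Finset.sum_image (f := fun j : ℕ => 1 / √(s + j * (d / 2))) hinj).symm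
    _ ≤ ∑ j ∈ Finset.range (J + 1), 1 / √(s + j * (d / 2)) :=
        Finset.sum_le_sum_of_subset_of_nonneg hsub fun _ _ _ => by positivity
    _ ≤ 1 + 2 / (d / 2) * (√(s + J * (d / 2)) - √s) :=
        sum_inv_sqrt_le (by nlinarith) (by positivity) J
    _ ≤ 1 + 4 / d * (2 * ρ + 2) := ?_
  -- `J d` is at most the range of `B`, namely `4aρ + 4ρ² + 2`. Subtracting `√s ≥ a` below cancels
  -- the only dependence on `a`.
  have h1 : √(s + J * (d / 2)) ≤ a + 2 * ρ + 2 := by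
    refine Real.sqrt_le_iff.2 ⟨by positivity, ?_⟩
    have : (0 : ℝ) ≤ J * d := by positivity
    nlinarith [mul_nonneg ha0 hρ]
  have h2 : a ≤ √s := Real.le_sqrt_of_sq_le (by linarith)
  have h3 : 2 / (d / 2) = 4 / d := by field_simp; norm_num
  rw [h3]
  gcongr
  linarith

/-- On either side of `q`, at distance at least `M`, the values `(l / L - q)²` are monotone in `l`
with increments at least `2M / L`. -/
theorem sum_volume_sq_near_lattice_le {L M : ℝ} (hL : 0 < L) (hM : 0 < M) (A : Finset ℤ)
    (q c p : ℝ) {ρ : ℝ} (hρ : 0 ≤ ρ) :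
    ∑ l ∈ A with M ≤ |((l : ℤ) : ℝ) / L - q|,
        volume {x : ℝ | 0 ≤ x ∧ |x - p| ≤ ρ ∧ |x ^ 2 - ((l / L - q) ^ 2 + c)| ≤ 1} ≤
      ENNReal.ofReal (8 * (1 + 2 * L / M * (2 * ρ + 2))) := by
  classical
  have hd : 0 < 2 * M / L := by positivity
  have hdd : 4 / (2 * M / L) = 2 * L / M := by field_simp; norm_num
  set V : ℤ → ℝ≥0∞ := fun l =>
    volume {x : ℝ | 0 ≤ x ∧ |x - p| ≤ ρ ∧ |x ^ 2 - ((l / L - q) ^ 2 + c)| ≤ 1} with hV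
  have half : ∀ q' : ℝ, ∀ A' : Finset ℤ, (∀ l ∈ A', M ≤ (l : ℝ) / L - q') →
      ∑ l ∈ A', volume {x : ℝ | 0 ≤ x ∧ |x - p| ≤ ρ ∧ |x ^ 2 - ((l / L - q') ^ 2 + c)| ≤ 1} ≤
        ENNReal.ofReal (4 * (1 + 2 * L / M * (2 * ρ + 2))) := by
    intro q' A' hA'
    rw [← hdd]
    refine sum_volume_sq_near_le (B := fun l : ℤ => ((l : ℝ) / L - q') ^ 2 + c) hd
      (fun l hl l' hl' hll => ?_) p hρ
    have h1 := hA' l hl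
    have h2 := hA' l' hl'
    have h3 : (0 : ℝ) ≤ (l' : ℝ) - l := sub_nonneg.2 (by exact_mod_cast hll)
    have h4 : 0 ≤ ((l' : ℝ) - l) / L := by positivity
    calc 2 * M / L * ((l' : ℝ) - l) = ((l' : ℝ) - l) / L * (2 * M) := by ring
      _ ≤ ((l' : ℝ) - l) / L * ((l' / L - q') + (l / L - q')) := by gcongr; linarith
      _ = _ := by ring
  have hsplit : (A.filter fun l : ℤ => M ≤ |(l : ℝ) / L - q|) ⊆
      (A.filter fun l : ℤ => M ≤ (l : ℝ) / L - q) ∪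
        (A.filter fun l : ℤ => M ≤ -((l : ℝ) / L - q)) := by
    intro l hl
    simp only [Finset.mem_filter, Finset.mem_union] at hl ⊢
    rcases le_abs.1 hl.2 with h | h
    · exact Or.inl ⟨hl.1, h⟩
    · exact Or.inr ⟨hl.1, h⟩
  have h1 : ∑ l ∈ A.filter (fun l : ℤ => M ≤ (l : ℝ) / L - q), V l ≤
      ENNReal.ofReal (4 * (1 + 2 * L / M * (2 * ρ + 2))) :=
    half q _ fun l hl => (Finset.mem_filter.1 hl).2
  have h2 : ∑ l ∈ A.filter (fun l : ℤ => M ≤ -((l : ℝ) / L - q)), V l ≤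
      ENNReal.ofReal (4 * (1 + 2 * L / M * (2 * ρ + 2))) := by
    -- The reflection `l ↦ -l`, `q ↦ -q` preserves the square and reduces this side to the other.
    refine le_trans (le_of_eq ?_) (half (-q)
      ((A.filter (fun l : ℤ => M ≤ -((l : ℝ) / L - q))).image fun l => -l) fun l hl => ?_)
    · rw [Finset.sum_image fun _ _ _ _ h => neg_injective h]
      refine Finset.sum_congr rfl fun l _ => ?_
      simp only [hV, Int.cast_neg]
      congr! 7
      ring
    · obtain ⟨k, hk, rfl⟩ := Finset.mem_image.1 hl
      have := (Finset.mem_filter.1 hk).2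
      push_cast
      rw [neg_div]
      linarith
  calc _ ≤ _ := Finset.sum_le_sum_of_subset (f := V) hsplit
    _ ≤ _ := le_self_add.trans_eq Finset.sum_union_inter
    _ ≤ _ := add_le_add h1 h2
    _ = _ := by
      rw [← ENNReal.ofReal_add (by positivity) (by positivity)]
      congr 1
      ring

/-- The frequencies `(η, l / L)` of size at most `ρ` for which `(ξ, n / L) - (η, l / L)` has size
at least `8 M`. -/
def separatedFreq (L ρ M : ℝ) (n : ℤ) (ξ : ℝ) : Set (ℤ × ℝ) :=
  {y | y.2 ^ 2 + (y.1 / L) ^ 2 ≤ ρ ^ 2 ∧ (8 * M) ^ 2 ≤ (ξ - y.2) ^ 2 + (((n - y.1 : ℤ) : ℝ) / L) ^ 2}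

/-- The nonconstant part of the time frequency of the product of two plane waves. -/
noncomputable def resonance (L : ℝ) (n : ℤ) (ξ : ℝ) (y : ℤ × ℝ) : ℝ :=
  (y.2 - ξ / 2) ^ 2 - (y.1 / L - n / (2 * L)) ^ 2

theorem card_Icc_le_of_one_le {s : ℝ} (hs : 1 ≤ s) :
    ((Finset.Icc ⌈-s⌉ ⌊s⌋).card : ℝ) ≤ 3 * s := by
  rw [Int.card_Icc]
  have h1 : ⌈-s⌉ ≤ 0 := Int.ceil_le.2 (by push_cast; linarith)
  have h2 : (0 : ℤ) ≤ ⌊s⌋ := Int.floor_nonneg.2 (by linarith)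
  have h3 : (((⌊s⌋ + 1 - ⌈-s⌉).toNat : ℕ) : ℤ) = ⌊s⌋ + 1 - ⌈-s⌉ :=
    Int.toNat_of_nonneg (by omega)
  have h4 : (((⌊s⌋ + 1 - ⌈-s⌉).toNat : ℕ) : ℝ) = ⌊s⌋ + 1 - ⌈-s⌉ := by exact_mod_cast h3
  rw [h4]
  linarith [Int.floor_le s, Int.le_ceil (-s)]

/-- Separation forces `|x| ≥ M` or `|z| ≥ M`. Where only the first holds, every slice has length
`O(1 / M)` and there are `O(ρL)` slices (sets `P`). Where the second holds, slices are summed using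
the spacing in `l` (sets `Q`). Negative `x` is reflected to positive `x` in both cases. -/
theorem tsum_volume_resonance_le {L ρ M : ℝ} (hL : 1 ≤ L) (hρ : 1 ≤ ρ) (hM : 0 < M)
    (hρM : ρ ≤ 4 * M) (n : ℤ) (ξ c : ℝ) :
    ∑' l : ℤ, volume {η : ℝ | (l, η) ∈ separatedFreq L ρ M n ξ ∧
        |resonance L n ξ (l, η) - c| ≤ 1} ≤ ENNReal.ofReal (140 * (1 + ρ * L / M)) := by
  classical
  have hL0 : 0 < L := by linarith
  set E : ℤ → Set ℝ := fun l => {η : ℝ | (l, η) ∈ separatedFreq L ρ M n ξ ∧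
    |resonance L n ξ (l, η) - c| ≤ 1}
  set q : ℝ := n / (2 * L) with hq
  set A := Finset.Icc ⌈-(ρ * L)⌉ ⌊ρ * L⌋ with hA
  set P : ℤ → Set ℝ := fun l => {x : ℝ | M ≤ x ∧ |x ^ 2 - ((l / L - q) ^ 2 + c)| ≤ 1}
  set Q : ℝ → ℤ → Set ℝ := fun p l =>
    {x : ℝ | 0 ≤ x ∧ |x - p| ≤ ρ ∧ |x ^ 2 - ((l / L - q) ^ 2 + c)| ≤ 1}
  have hEA : ∀ l, l ∉ A → volume (E l) = 0 := by
    intro l hl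
    have : E l = ∅ := by
      refine Set.eq_empty_of_forall_notMem fun η hη => hl ?_
      have h1 : η ^ 2 + (l / L) ^ 2 ≤ ρ ^ 2 := hη.1.1
      obtain ⟨h2, h3⟩ := abs_le.1 (abs_le_of_sq_le_sq (by nlinarith : ((l : ℝ) / L) ^ 2 ≤ ρ ^ 2)
        (by linarith))
      rw [le_div_iff₀ hL0] at h2
      rw [div_le_iff₀ hL0] at h3
      exact Finset.mem_Icc.2 ⟨Int.ceil_le.2 (by linarith), Int.le_floor.2 h3⟩
    rw [this, measure_empty]
  have hE : ∀ l, volume (E l) ≤ 2 * volume (P l) +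
      if M ≤ |(l : ℝ) / L - q| then volume (Q (-(ξ / 2)) l) + volume (Q (ξ / 2) l) else 0 := by
    intro l
    set F : Set ℝ := (P l ∪ (Neg.neg ⁻¹' P l)) ∪
      (if M ≤ |(l : ℝ) / L - q| then Q (-(ξ / 2)) l ∪ (Neg.neg ⁻¹' Q (ξ / 2) l) else ∅)
    have hsub : E l ⊆ (fun η => η + (-(ξ / 2))) ⁻¹' F := by
      rintro η ⟨⟨h1, h2⟩, h3⟩
      simp only [resonance] at h3
      simp only at h1 h2
      set x := η - ξ / 2 with hx
      set z := (l : ℝ) / L - q with hz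
      have hη : η = x + ξ / 2 := by rw [hx]; ring
      have hn : (((n - l : ℤ) : ℝ) / L) = l / L - 2 * z := by
        rw [hz, hq]; push_cast; field_simp; ring
      have hxi : ξ - η = η - 2 * x := by rw [hx]; ring
      rw [hn, hxi] at h2
      have h3' : |x ^ 2 - (z ^ 2 + c)| ≤ 1 := by rwa [← sub_sub]
      have hηρ : |η| ≤ ρ := abs_le_of_sq_le_sq (by nlinarith [sq_nonneg ((l : ℝ) / L)]) (by linarith)
      -- The high frequency is the low one minus `2(x, z)`. If both `|x|` and `|z|` were below `M`,
      -- its square would be below `2ρ² + 16M² ≤ 48M² < (8M)²`.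
      have hxz : M ≤ |x| ∨ M ≤ |z| := by
        by_contra! h
        have hx2 : x ^ 2 < M ^ 2 := sq_lt_sq' (by linarith [neg_abs_le x]) (by linarith [le_abs_self x])
        have hz2 : z ^ 2 < M ^ 2 := sq_lt_sq' (by linarith [neg_abs_le z]) (by linarith [le_abs_self z])
        have : ρ ^ 2 ≤ (4 * M) ^ 2 := pow_le_pow_left₀ (by linarith) hρM 2
        nlinarith [sq_nonneg (η + 2 * x), sq_nonneg ((l : ℝ) / L + 2 * z)]
      have hxe : η + -(ξ / 2) = x := by rw [hx]; ring
      change η + -(ξ / 2) ∈ F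
      rw [hxe]
      by_cases hzM : M ≤ |z|
      · right
        rw [if_pos hzM]
        rcases le_total 0 x with h0 | h0
        · left
          refine ⟨h0, ?_, h3'⟩
          rwa [sub_neg_eq_add, ← hη]
        · right
          refine ⟨by linarith, ?_, by rwa [neg_sq]⟩
          rwa [show -x - ξ / 2 = -η by rw [hη]; ring, abs_neg]
      · left
        rcases le_abs.1 (hxz.resolve_right hzM) with h0 | h0
        · exact Or.inl ⟨h0, h3'⟩
        · exact Or.inr ⟨h0, by rwa [neg_sq]⟩
    refine (measure_mono hsub).trans ?_
    rw [measure_preimage_add_right]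
    refine (measure_union_le _ _).trans (add_le_add ?_ ?_)
    · refine (measure_union_le _ _).trans (le_of_eq ?_)
      rw [Measure.measure_preimage_neg, two_mul]
    · split_ifs
      · refine (measure_union_le _ _).trans (le_of_eq ?_)
        rw [Measure.measure_preimage_neg]
      · simp
  have hP : ∀ l, volume (P l) ≤ ENNReal.ofReal (2 / M) := by
    intro l
    refine (volume_sq_near_le hM.le _).trans (ENNReal.ofReal_le_ofReal ?_)
    gcongr
    exact Real.le_sqrt_of_sq_le (by linarith [le_max_left (M ^ 2) ((l / L - q) ^ 2 + c - 1)])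
  have hρL : 1 ≤ ρ * L := one_le_mul_of_one_le_of_one_le hρ hL
  calc ∑' l : ℤ, volume (E l) = ∑ l ∈ A, volume (E l) := tsum_eq_sum fun l hl => hEA l hl
    _ ≤ ∑ l ∈ A, (2 * ENNReal.ofReal (2 / M) +
        if M ≤ |(l : ℝ) / L - q| then volume (Q (-(ξ / 2)) l) + volume (Q (ξ / 2) l) else 0) :=
      Finset.sum_le_sum fun l _ => (hE l).trans (by gcongr; exact hP l)
    _ = A.card * (2 * ENNReal.ofReal (2 / M)) +
        (∑ l ∈ A with M ≤ |((l : ℤ) : ℝ) / L - q|, volume (Q (-(ξ / 2)) l) +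
          ∑ l ∈ A with M ≤ |((l : ℤ) : ℝ) / L - q|, volume (Q (ξ / 2) l)) := by
      rw [Finset.sum_add_distrib, Finset.sum_const, nsmul_eq_mul, ← Finset.sum_filter,
        Finset.sum_add_distrib]
    _ ≤ ENNReal.ofReal (3 * (ρ * L)) * ENNReal.ofReal (4 / M) +
        (ENNReal.ofReal (8 * (1 + 2 * L / M * (2 * ρ + 2))) +
          ENNReal.ofReal (8 * (1 + 2 * L / M * (2 * ρ + 2)))) := by
      refine add_le_add (mul_le_mul' ?_ (le_of_eq ?_)) (add_le_add
        (sum_volume_sq_near_lattice_le hL0 hM A q c _ (by linarith))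
        (sum_volume_sq_near_lattice_le hL0 hM A q c _ (by linarith)))
      · rw [← ENNReal.ofReal_natCast]
        exact ENNReal.ofReal_le_ofReal (card_Icc_le_of_one_le hρL)
      · rw [← ENNReal.ofReal_ofNat 2, ← ENNReal.ofReal_mul (by norm_num)]
        congr 1
        ring
    _ ≤ _ := by
      rw [← ENNReal.ofReal_mul (by positivity), ← ENNReal.ofReal_add (by positivity) (by positivity),
        ← ENNReal.ofReal_add (by positivity) (by positivity)]
      refine ENNReal.ofReal_le_ofReal ?_
      -- The constant 140 is `12 + 16 · 8`: the steep slices give `12ρL / M`, the two lattice sums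
      -- `16 (1 + 8ρL / M)`.
      have h1 : 2 * L / M * (2 * ρ + 2) ≤ 8 * (ρ * L / M) := by
        calc 2 * L / M * (2 * ρ + 2) ≤ 2 * L / M * (4 * ρ) := by gcongr; linarith
          _ = _ := by ring
      have h2 : 3 * (ρ * L) * (4 / M) = 12 * (ρ * L / M) := by ring
      rw [h2]
      have : 0 ≤ ρ * L / M := by positivity
      linarith

/-! ### `TT*` in time with a Gaussian weight -/

theorem integral_gaussian_mul_exp (s : ℝ) :
    ∫ t : ℝ, (Real.exp (1 - t ^ 2) : ℂ) * Complex.exp ((-(s * t) : ℝ) * Complex.I) =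
      (Real.exp 1 * √Real.pi * Real.exp (-(s ^ 2 / 4)) : ℝ) := by
  have h := fourierIntegral_gaussian (b := 1) (by simp) (-(s : ℂ))
  have e : ∀ t : ℝ, (Real.exp (1 - t ^ 2) : ℂ) * Complex.exp ((-(s * t) : ℝ) * Complex.I) =
      Real.exp 1 * (Complex.exp (Complex.I * (-(s : ℂ)) * t) * Complex.exp (-1 * (t : ℂ) ^ 2)) := by
    intro t
    push_cast
    rw [← Complex.exp_add, ← Complex.exp_add, ← Complex.exp_add]
    congr 1
    ring
  simp_rw [e]
  rw [integral_const_mul, h]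
  push_cast
  have : ((Real.pi : ℂ) / 1) ^ (1 / 2 : ℂ) = (√Real.pi : ℝ) := by
    rw [div_one, Real.sqrt_eq_rpow, Complex.ofReal_cpow Real.pi_pos.le]
    norm_num
  rw [this]
  have e2 : -(-(s : ℂ)) ^ 2 / (4 * 1) = -((s : ℂ) ^ 2 / 4) := by ring
  rw [e2]
  ring

/-- Weighted `TT*` bound: the kernel of the quadratic form is the Fourier transform of a Gaussian
that dominates the indicator function of `[0, 1]`. -/
theorem lintegral_sq_oscillatory_le {Y : Type*} [MeasurableSpace Y] {μ : Measure Y} [SFinite μ]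
    {G : Y → ℂ} (hG : Integrable G μ) (hGm : Measurable G) {φ : Y → ℝ} (hφ : Measurable φ)
    {S : Set Y} (hS : ∀ y, G y ≠ 0 → y ∈ S) (hSm : MeasurableSet S) {D : ℝ≥0∞}
    (hD : ∀ y ∈ S, ∫⁻ y' in S, ENNReal.ofReal (Real.exp (-((φ y - φ y') ^ 2 / 4))) ∂μ ≤ D) :
    ∫⁻ t in Set.Icc (0 : ℝ) 1,
        ‖∫ y, G y * Complex.exp ((-(φ y * t) : ℝ) * Complex.I) ∂μ‖ₑ ^ 2 ≤
      ENNReal.ofReal (Real.exp 1 * √Real.pi) * D * ∫⁻ y, ‖G y‖ₑ ^ 2 ∂μ := by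
  set g : ℝ → ℝ := fun t => Real.exp (1 - t ^ 2) with hg
  have hgc : Continuous g := by fun_prop
  have hgi : Integrable g := by
    have := (integrable_exp_neg_mul_sq (b := 1) one_pos).const_mul (Real.exp 1)
    refine this.congr (Filter.Eventually.of_forall fun t => ?_)
    simp only [hg]
    rw [← Real.exp_add]
    congr 1
    ring
  set U : ℝ → ℂ := fun t => ∫ y, G y * Complex.exp ((-(φ y * t) : ℝ) * Complex.I) ∂μ with hU
  set w : Y × Y → ℂ := fun p => G p.1 * (starRingEnd ℂ) (G p.2) with hw
  have hwi : Integrable w (μ.prod μ) := by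
    have h2 : Integrable (fun y => (starRingEnd ℂ) (G y)) μ :=
      (Complex.conjLIE.toContinuousLinearEquiv.toContinuousLinearMap).integrable_comp hG
    exact hG.mul_prod h2
  have hwm : Measurable w := by
    have h1 : Measurable fun p : Y × Y => G p.2 := hGm.comp measurable_snd
    exact (hGm.comp measurable_fst).mul (Complex.continuous_conj.measurable.comp h1)
  set F : ℝ × (Y × Y) → ℂ := fun p => (g p.1 : ℂ) * Complex.exp
    ((-((φ p.2.1 - φ p.2.2) * p.1) : ℝ) * Complex.I) * w p.2 with hF
  have hFm : Measurable F := by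
    have h1 : Measurable fun p : ℝ × (Y × Y) => φ p.2.1 := hφ.comp (by fun_prop)
    have h2 : Measurable fun p : ℝ × (Y × Y) => φ p.2.2 := hφ.comp (by fun_prop)
    have h3 : Measurable fun p : ℝ × (Y × Y) => g p.1 := hgc.measurable.comp measurable_fst
    have h4 : Measurable fun p : ℝ × (Y × Y) => w p.2 := hwm.comp measurable_snd
    fun_prop
  have hFi : Integrable F (volume.prod (μ.prod μ)) := by
    have h1 : Integrable (fun p : ℝ × (Y × Y) => (g p.1 : ℂ) * w p.2) (volume.prod (μ.prod μ)) :=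
      hgi.ofReal.mul_prod hwi
    refine h1.mono hFm.aestronglyMeasurable (Filter.Eventually.of_forall fun p => ?_)
    simp only [hF, norm_mul, Complex.norm_exp_ofReal_mul_I, mul_one, le_refl]
  have hUsq : ∀ t, ((g t * ‖U t‖ ^ 2 : ℝ) : ℂ) = ∫ p, F (t, p) ∂(μ.prod μ) := by
    intro t
    have e1 : (starRingEnd ℂ) (U t) =
        ∫ y, (starRingEnd ℂ) (G y * Complex.exp ((-(φ y * t) : ℝ) * Complex.I)) ∂μ :=
      integral_conj.symm
    have e2 : ((‖U t‖ ^ 2 : ℝ) : ℂ) = U t * (starRingEnd ℂ) (U t) := by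
      rw [Complex.mul_conj, Complex.normSq_eq_norm_sq]
    rw [Complex.ofReal_mul, e2, e1, ← integral_prod_mul, ← integral_const_mul]
    refine integral_congr_ae (Filter.Eventually.of_forall fun p => ?_)
    simp only [hF, hw, map_mul, ← Complex.exp_conj, Complex.conj_ofReal, Complex.conj_I]
    have : Complex.exp ((-((φ p.1 - φ p.2) * t) : ℝ) * Complex.I) =
        Complex.exp ((-(φ p.1 * t) : ℝ) * Complex.I) *
          Complex.exp ((-(φ p.2 * t) : ℝ) * -Complex.I) := by
      rw [← Complex.exp_add]
      congr 1
      push_cast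
      ring
    rw [this]
    ring
  have hint : Integrable (fun t => ((g t * ‖U t‖ ^ 2 : ℝ) : ℂ)) := by
    simp_rw [hUsq]
    exact hFi.integral_prod_left
  have hintR : Integrable (fun t => g t * ‖U t‖ ^ 2) := by
    have := hint.re
    simpa only [RCLike.re_to_complex, Complex.ofReal_re] using this
  -- Fubini moves the time integral inside, where it becomes the positive Gaussian kernel in the
  -- phase difference.
  have hval : ((∫ t, g t * ‖U t‖ ^ 2 : ℝ) : ℂ) =
      ∫ p, ((Real.exp 1 * √Real.pi * Real.exp (-((φ p.1 - φ p.2) ^ 2 / 4)) : ℝ) : ℂ) * w p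
        ∂(μ.prod μ) := by
    rw [← integral_complex_ofReal]
    simp_rw [hUsq]
    rw [integral_integral_swap hFi]
    refine integral_congr_ae (Filter.Eventually.of_forall fun p => ?_)
    simp only [hF]
    rw [integral_mul_const, ← integral_gaussian_mul_exp]
  set k : Y × Y → ℝ≥0∞ := fun p => ENNReal.ofReal (Real.exp (-((φ p.1 - φ p.2) ^ 2 / 4))) with hk
  have hkm : Measurable k := by
    have h1 : Measurable fun p : Y × Y => φ p.1 := hφ.comp measurable_fst
    have h2 : Measurable fun p : Y × Y => φ p.2 := hφ.comp measurable_snd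
    fun_prop
  have hks : ∀ y y', k (y, y') = k (y', y) := by
    intro y y'
    simp only [hk]
    rw [← neg_sub (φ y) (φ y'), neg_sq]
  -- Schur's test for a symmetric kernel: by the arithmetic-geometric mean inequality, only the
  -- integral of the kernel in one variable over `S` matters.
  have hpt : ∀ y y', ‖G y‖ₑ * ‖G y'‖ₑ ≤
      (‖G y‖ₑ ^ 2 * S.indicator 1 y' + ‖G y'‖ₑ ^ 2 * S.indicator 1 y) / 2 := by
    intro y y'
    by_cases h1 : G y = 0
    · simp [h1]
    by_cases h2 : G y' = 0
    · simp [h2]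
    rw [Set.indicator_of_mem (hS _ h1), Set.indicator_of_mem (hS _ h2)]
    simp only [Pi.one_apply, mul_one]
    rw [ENNReal.le_div_iff_mul_le (by simp) (by simp), ← ofReal_norm, ← ofReal_norm,
      ← ENNReal.ofReal_mul (norm_nonneg _), ← ENNReal.ofReal_pow (norm_nonneg _),
      ← ENNReal.ofReal_pow (norm_nonneg _), ← ENNReal.ofReal_add (by positivity) (by positivity),
      ← ENNReal.ofReal_ofNat 2, ← ENNReal.ofReal_mul (by positivity)]
    exact ENNReal.ofReal_le_ofReal (by nlinarith [sq_nonneg (‖G y‖ - ‖G y'‖)])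
  have hA : ∫⁻ y, ∫⁻ y', k (y, y') * (‖G y‖ₑ ^ 2 * S.indicator 1 y') ∂μ ∂μ ≤
      D * ∫⁻ y, ‖G y‖ₑ ^ 2 ∂μ := by
    rw [← lintegral_const_mul _ (by fun_prop)]
    refine lintegral_mono fun y => ?_
    by_cases h1 : G y = 0
    · simp [h1]
    have e : ∀ y', k (y, y') * (‖G y‖ₑ ^ 2 * S.indicator 1 y') =
        ‖G y‖ₑ ^ 2 * S.indicator (fun y' => k (y, y')) y' := by
      intro y'
      by_cases hy : y' ∈ S
      · simp [hy, mul_comm]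
      · simp [hy]
    simp_rw [e]
    rw [lintegral_const_mul' _ _ (by simp), lintegral_indicator hSm, mul_comm]
    gcongr
    exact hD y (hS y h1)
  have hgm : Measurable fun y => ‖G y‖ₑ ^ 2 := by fun_prop
  have hind : Measurable (S.indicator (1 : Y → ℝ≥0∞)) := measurable_one.indicator hSm
  have hB : ∫⁻ p, k p * (‖G p.1‖ₑ * ‖G p.2‖ₑ) ∂(μ.prod μ) ≤ D * ∫⁻ y, ‖G y‖ₑ ^ 2 ∂μ := by
    have m1 : Measurable fun p : Y × Y => k p * (‖G p.1‖ₑ ^ 2 * S.indicator 1 p.2) :=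
      hkm.mul ((hgm.comp measurable_fst).mul (hind.comp measurable_snd))
    have m2 : Measurable fun p : Y × Y => k p * (‖G p.2‖ₑ ^ 2 * S.indicator 1 p.1) :=
      hkm.mul ((hgm.comp measurable_snd).mul (hind.comp measurable_fst))
    calc _ ≤ ∫⁻ p, (k p * (‖G p.1‖ₑ ^ 2 * S.indicator 1 p.2) +
            k p * (‖G p.2‖ₑ ^ 2 * S.indicator 1 p.1)) / 2 ∂(μ.prod μ) := by
          refine lintegral_mono fun p => ?_
          rw [← mul_add, mul_div_assoc]
          gcongr
          exact hpt p.1 p.2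
      _ = ((∫⁻ p, k p * (‖G p.1‖ₑ ^ 2 * S.indicator 1 p.2) ∂(μ.prod μ)) +
            ∫⁻ p, k p * (‖G p.2‖ₑ ^ 2 * S.indicator 1 p.1) ∂(μ.prod μ)) / 2 := by
          simp only [div_eq_mul_inv]
          rw [lintegral_mul_const' _ _ (by simp), lintegral_add_left m1]
      _ ≤ (D * ∫⁻ y, ‖G y‖ₑ ^ 2 ∂μ + D * ∫⁻ y, ‖G y‖ₑ ^ 2 ∂μ) / 2 := by
          gcongr
          · rw [lintegral_prod _ m1.aemeasurable]
            exact hA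
          · rw [lintegral_prod_symm _ m2.aemeasurable]
            refine le_trans (le_of_eq ?_) hA
            refine lintegral_congr fun y => lintegral_congr fun y' => ?_
            rw [hks y' y]
      _ = _ := by rw [← two_mul, mul_comm, ENNReal.mul_div_cancel_right (by simp) (by simp)]
  calc ∫⁻ t in Set.Icc (0 : ℝ) 1, ‖U t‖ₑ ^ 2
      ≤ ∫⁻ t in Set.Icc (0 : ℝ) 1, ENNReal.ofReal (g t * ‖U t‖ ^ 2) := by
        refine setLIntegral_mono' measurableSet_Icc fun t ht => ?_
        rw [← ofReal_norm, ← ENNReal.ofReal_pow (norm_nonneg _)]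
        refine ENNReal.ofReal_le_ofReal (le_mul_of_one_le_left (by positivity) ?_)
        exact Real.one_le_exp (by nlinarith [ht.1, ht.2])
    _ ≤ ∫⁻ t, ENNReal.ofReal (g t * ‖U t‖ ^ 2) := setLIntegral_le_lintegral _ _
    _ = ENNReal.ofReal (∫ t, g t * ‖U t‖ ^ 2) := by
        rw [ofReal_integral_eq_lintegral_ofReal hintR
          (Filter.Eventually.of_forall fun t => by positivity)]
    _ ≤ ‖((∫ t, g t * ‖U t‖ ^ 2 : ℝ) : ℂ)‖ₑ := by
        rw [← ofReal_norm, Complex.norm_real]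
        exact ENNReal.ofReal_le_ofReal (Real.le_norm_self _)
    _ ≤ ∫⁻ p, ‖((Real.exp 1 * √Real.pi * Real.exp (-((φ p.1 - φ p.2) ^ 2 / 4)) : ℝ) : ℂ) * w p‖ₑ
        ∂(μ.prod μ) := by
        rw [hval]
        exact enorm_integral_le_lintegral_enorm _
    _ = ENNReal.ofReal (Real.exp 1 * √Real.pi) *
        ∫⁻ p, k p * (‖G p.1‖ₑ * ‖G p.2‖ₑ) ∂(μ.prod μ) := by
        rw [← lintegral_const_mul' _ _ ENNReal.ofReal_ne_top]
        refine lintegral_congr fun p => ?_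
        simp only [hk, hw, enorm_mul]
        rw [← ofReal_norm, Complex.norm_real, Real.norm_of_nonneg (by positivity),
          ENNReal.ofReal_mul (by positivity), mul_assoc]
        congr 3
        rw [← ofReal_norm, RCLike.norm_conj, ofReal_norm]
    _ ≤ _ := by
        rw [mul_assoc]
        gcongr

/-! ### From Gaussian kernels to unit windows -/

theorem exp_neg_sq_le_tsum (s : ℝ) :
    ENNReal.ofReal (Real.exp (-s ^ 2)) ≤
      ∑' m : ℤ, ENNReal.ofReal (4 / (1 + (m : ℝ) ^ 2)) *
        Set.indicator {x : ℝ | |x| ≤ 1} 1 (s - m) := by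
  refine le_trans ?_ (ENNReal.le_tsum ⌊s⌋)
  have h1 := Int.floor_le s
  have h2 := Int.lt_floor_add_one s
  rw [Set.indicator_of_mem (by
    change |s - ⌊s⌋| ≤ 1
    rw [abs_le]
    constructor <;> linarith), Pi.one_apply, mul_one]
  refine ENNReal.ofReal_le_ofReal ?_
  rw [Real.exp_neg, ← one_div, div_le_div_iff₀ (Real.exp_pos _) (by positivity)]
  have h3 := Real.add_one_le_exp (s ^ 2)
  nlinarith [sq_nonneg ((⌊s⌋ : ℝ) - 2 * s), sq_nonneg (s - ⌊s⌋)]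

theorem tsum_four_div_one_add_sq_ne_top :
    ∑' m : ℤ, ENNReal.ofReal (4 / (1 + (m : ℝ) ^ 2)) ≠ ∞ := by
  have h : Summable fun m : ℤ => 4 / (1 + (m : ℝ) ^ 2) := by
    have h1 : Summable fun m : ℤ => 1 / (m : ℝ) ^ 2 :=
      Real.summable_one_div_int_pow.2 one_lt_two
    have h2 : Summable fun m : ℤ => 4 * (1 / (m : ℝ) ^ 2) + Set.indicator {0} (fun _ => (4 : ℝ)) m :=
      (h1.mul_left 4).add (summable_of_hasFiniteSupport
        ((Set.finite_singleton (0 : ℤ)).subset Set.support_indicator_subset))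
    refine h2.of_nonneg_of_le (fun m => by positivity) fun m => ?_
    by_cases hm : m = 0
    · simp [hm]
    · have : (0 : ℝ) < (m : ℝ) ^ 2 := by positivity
      rw [Set.indicator_of_notMem (by simpa using hm), add_zero, mul_one_div]
      gcongr
      linarith
  exact h.tsum_ofReal_ne_top

theorem measurableSet_separatedFreq (L ρ M : ℝ) (n : ℤ) (ξ : ℝ) :
    MeasurableSet (separatedFreq L ρ M n ξ) := by
  have h1 : Measurable fun y : ℤ × ℝ => (y.1 : ℝ) := measurable_from_top.comp measurable_fst
  have h2 : Measurable fun y : ℤ × ℝ => ((n - y.1 : ℤ) : ℝ) :=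
    (measurable_from_top (f := fun l : ℤ => ((n - l : ℤ) : ℝ))).comp measurable_fst
  have h3 : Measurable fun y : ℤ × ℝ => y.2 ^ 2 + ((y.1 : ℝ) / L) ^ 2 := by fun_prop
  have h4 : Measurable fun y : ℤ × ℝ => (ξ - y.2) ^ 2 + (((n - y.1 : ℤ) : ℝ) / L) ^ 2 := by
    fun_prop
  exact (measurableSet_le h3 measurable_const).inter (measurableSet_le measurable_const h4)

theorem measurable_resonance (L : ℝ) (n : ℤ) (ξ : ℝ) : Measurable (resonance L n ξ) := by
  have h1 : Measurable fun y : ℤ × ℝ => (y.1 : ℝ) := measurable_from_top.comp measurable_fst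
  unfold resonance
  fun_prop

/-- The window bound is uniform in the centre, here `c + m`, so the summable weights factor out. -/
theorem lintegral_exp_neg_resonance_le {L ρ M : ℝ} (hL : 1 ≤ L) (hρ : 1 ≤ ρ) (hM : 0 < M)
    (hρM : ρ ≤ 4 * M) (n : ℤ) (ξ c : ℝ) :
    ∫⁻ y in separatedFreq L ρ M n ξ, ENNReal.ofReal (Real.exp (-(resonance L n ξ y - c) ^ 2))
        ∂(Measure.count.prod volume) ≤
      (∑' m : ℤ, ENNReal.ofReal (4 / (1 + (m : ℝ) ^ 2))) *
        ENNReal.ofReal (140 * (1 + ρ * L / M)) := by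
  set S := separatedFreq L ρ M n ξ
  have hS : MeasurableSet S := measurableSet_separatedFreq L ρ M n ξ
  have hθ := measurable_resonance L n ξ
  have hT : ∀ m : ℤ, MeasurableSet {y : ℤ × ℝ | |resonance L n ξ y - c - m| ≤ 1} := fun m =>
    measurableSet_le (by fun_prop) measurable_const
  calc _ ≤ ∫⁻ y in S, ∑' m : ℤ, ENNReal.ofReal (4 / (1 + (m : ℝ) ^ 2)) *
          Set.indicator {y : ℤ × ℝ | |resonance L n ξ y - c - m| ≤ 1} 1 y
          ∂(Measure.count.prod volume) :=
        lintegral_mono fun y => exp_neg_sq_le_tsum _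
    _ = ∑' m : ℤ, ENNReal.ofReal (4 / (1 + (m : ℝ) ^ 2)) *
          Measure.count.prod volume ({y : ℤ × ℝ | |resonance L n ξ y - c - m| ≤ 1} ∩ S) := by
        rw [lintegral_tsum fun m => ((measurable_one.indicator (hT m)).const_mul _).aemeasurable]
        refine tsum_congr fun m => ?_
        rw [lintegral_const_mul' _ _ ENNReal.ofReal_ne_top, lintegral_indicator_one (hT m),
          Measure.restrict_apply (hT m)]
    _ ≤ ∑' m : ℤ, ENNReal.ofReal (4 / (1 + (m : ℝ) ^ 2)) *
          ENNReal.ofReal (140 * (1 + ρ * L / M)) := by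
        refine ENNReal.tsum_le_tsum fun m => ?_
        gcongr
        rw [Measure.prod_apply ((hT m).inter hS), lintegral_count]
        refine le_trans (le_of_eq (tsum_congr fun l => ?_))
          (tsum_volume_resonance_le hL hρ hM hρM n ξ (c + m))
        congr 1
        ext η
        simp only [Set.mem_preimage, Set.mem_inter_iff, Set.mem_ofPred_eq, sub_sub]
        exact and_comm
    _ = _ := ENNReal.tsum_mul_right

/-! ### The inverse Fourier transform on `L¹` and `L²` of the line -/

theorem integral_fourierInv_mul_eq {f g : ℝ → ℂ} (hf : Integrable f) (hg : Integrable g) :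
    ∫ x, 𝓕⁻ f x * g x = ∫ x, f x * 𝓕⁻ g x := by
  -- With the pairing negated, the general transform is the inverse one.
  have h := VectorFourier.integral_fourierIntegral_smul_eq_flip (L := -innerₗ ℝ) (μ := volume)
    (ν := volume) Real.continuous_fourierChar (continuous_inner.neg) hf hg
  have e1 : ∀ u : ℝ → ℂ, VectorFourier.fourierIntegral Real.fourierChar volume (-innerₗ ℝ) u =
      𝓕⁻ u := by
    intro u
    ext x
    simp [VectorFourier.fourierIntegral, Real.fourierInv_eq]
  have e2 : ∀ u : ℝ → ℂ,
      VectorFourier.fourierIntegral Real.fourierChar volume (-innerₗ ℝ).flip u = 𝓕⁻ u := by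
    intro u
    ext x
    simp [VectorFourier.fourierIntegral, Real.fourierInv_eq, mul_comm]
  simpa only [e1, e2, smul_eq_mul] using h

/-- The `L²` transform agrees with the distributional one, and the multiplication formula identifies
the latter with the integral when tested on smooth compactly supported functions. -/
theorem fourierInv_L2_ae_eq {f : Lp ℂ 2 (volume : Measure ℝ)} {g : ℝ → ℂ} (hg : Integrable g)
    (hfg : f =ᵐ[volume] g) :
    (𝓕⁻ f : Lp ℂ 2 (volume : Measure ℝ)) =ᵐ[volume] 𝓕⁻ g := by
  have hgc : Continuous (𝓕⁻ g) := by
    have : 𝓕⁻ g = fun x => 𝓕 g (-x) := funext fun x => Real.fourierInv_eq_fourier_neg g x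
    rw [this]
    exact (VectorFourier.fourierIntegral_continuous Real.continuous_fourierChar
      (by fun_prop) hg).comp continuous_neg
  refine ae_eq_of_integral_contDiff_smul_eq ((Lp.memLp _).locallyIntegrable (by norm_num))
    hgc.locallyIntegrable fun φ hφ hφc => ?_
  set ψ : SchwartzMap ℝ ℂ := HasCompactSupport.toSchwartzMap (f := fun x => (φ x : ℂ))
    (hφc.comp_left (g := fun r : ℝ => (r : ℂ)) (by simp)) (Complex.ofRealCLM.contDiff.comp hφ) with hψ
  have h := Lp.fourierInv_toTemperedDistribution_eq f
  have h2 := congrArg (fun T => T ψ) h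
  simp only [TemperedDistribution.fourierInv_apply, Lp.toTemperedDistribution_apply] at h2
  have h3 : ∫ x, (𝓕⁻ ψ) x • f x = ∫ x, (𝓕⁻ ψ) x • g x :=
    integral_congr_ae (hfg.mono fun x hx => by simp only [hx])
  change ∫ x, (𝓕⁻ ψ) x • f x = ∫ x, ψ x • (𝓕⁻ f : Lp ℂ 2 (volume : Measure ℝ)) x at h2
  have e : ∀ x (z : ℂ), φ x • z = ψ x • z := fun x z => Complex.real_smul
  simp only [e]
  rw [← h2, h3]
  simp only [SchwartzMap.fourierInv_coe, smul_eq_mul]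
  exact integral_fourierInv_mul_eq ψ.integrable hg

/-- This is Plancherel for `h` in `L²`; otherwise the right side is infinite. As an inequality it
applies to `productCoeff` without a proof that this lies in `L²`. -/
theorem eLpNorm_fourierInv_le {h : ℝ → ℂ} (hh : Integrable h) :
    eLpNorm (𝓕⁻ h) 2 volume ≤ eLpNorm h 2 volume := by
  by_cases hm : MemLp h 2 volume
  · have h1 := fourierInv_L2_ae_eq hh hm.coeFn_toLp
    rw [← eLpNorm_congr_ae h1, ← eLpNorm_congr_ae hm.coeFn_toLp]
    have h2 := Lp.norm_fourier_eq (𝓕⁻ (hm.toLp h))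
    rw [FourierTransform.fourier_fourierInv_eq] at h2
    rw [← Lp.enorm_def, ← Lp.enorm_def, ← ofReal_norm, ← ofReal_norm, h2]
  · have : eLpNorm h 2 volume = ∞ := by
      by_contra hne
      exact hm ⟨hh.1, lt_top_iff_ne_top.2 hne⟩
    rw [this]
    exact le_top

theorem fourierInv_mul_fourierInv {f g : ℝ → ℂ} (hf : Integrable f) (hg : Integrable g) (x : ℝ) :
    𝓕⁻ f x * 𝓕⁻ g x = 𝓕⁻ (fun ξ => ∫ η, f η * g (ξ - η)) x := by
  rw [Real.fourierInv_eq_fourier_neg, Real.fourierInv_eq_fourier_neg,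
    Real.fourierInv_eq_fourier_neg]
  exact (Real.fourier_mul_convolution_eq hf hg (-x)).symm

theorem integrable_conv {f g : ℝ → ℂ} (hf : Integrable f) (hg : Integrable g) :
    Integrable (fun ξ => ∫ η, f η * g (ξ - η)) :=
  hf.integrable_convolution (ContinuousLinearMap.mul ℂ ℂ) hg

theorem eLpNorm_two_sq {α : Type*} [MeasurableSpace α] (μ : Measure α) (f : α → ℂ) :
    eLpNorm f 2 μ ^ 2 = ∫⁻ x, ‖f x‖ₑ ^ 2 ∂μ := by
  have h := eLpNorm_nnreal_pow_eq_lintegral (f := f) (μ := μ) (p := 2) (by norm_num)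
  simpa only [ENNReal.coe_ofNat, NNReal.coe_ofNat, ENNReal.rpow_ofNat] using h

/-! ### Parseval on the circle and multipliers mode by mode -/

section Circle

variable {L : ℝ} [Fact (0 < L)]

theorem fourierCoeff_eq_const_mul_integral (g : AddCircle L → ℂ) (k : ℤ) :
    fourierCoeff g k = (1 / L : ℂ) * ∫ x, fourier (-k) x * g x := by
  rw [fourierCoeff, AddCircle.integral_haarAddCircle, Complex.real_smul]
  simp

theorem fourierCoeff_sum_fourier (S : Finset ℤ) (c : ℤ → ℂ) (j : ℤ) :
    fourierCoeff (fun x : AddCircle L => ∑ k ∈ S, fourier k x * c k) j =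
      if j ∈ S then c j else 0 := by
  have e : (fun x : AddCircle L => ∑ k ∈ S, fourier k x * c k) =
      ∑ k ∈ S, fun x : AddCircle L => c k * fourier k x := by
    ext x
    simp [mul_comm]
  rw [e, fourierCoeff.sum _ _ fun k _ =>
    ((fourier k).continuous.integrable_of_hasCompactSupport
      (HasCompactSupport.of_compactSpace _)).const_mul _, Finset.sum_apply]
  simp_rw [fourierCoeff.const_mul, fourierCoeff_fourier, Pi.single_apply, mul_ite, mul_one, mul_zero]
  rw [Finset.sum_ite_eq]

theorem lintegral_sq_eq_tsum_fourierCoeff {g : AddCircle L → ℂ} (hg : MemLp g 2 volume) :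
    ∫⁻ x, ‖g x‖ₑ ^ 2 = ENNReal.ofReal L * ∑' k : ℤ, ‖fourierCoeff g k‖ₑ ^ 2 := by
  have hg' : MemLp g 2 AddCircle.haarAddCircle := hg.haarAddCircle
  have hae := hg'.coeFn_toLp
  have h := hasSum_sq_fourierCoeff (hg'.toLp g)
  rw [fourierCoeff_congr_ae hae] at h
  have h1 : ∑' k : ℤ, ‖fourierCoeff g k‖ₑ ^ 2 =
      ENNReal.ofReal (∑' k : ℤ, ‖fourierCoeff g k‖ ^ 2) := by
    rw [ENNReal.ofReal_tsum_of_nonneg (fun _ => by positivity) h.summable]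
    simp_rw [ENNReal.ofReal_pow (norm_nonneg _), ofReal_norm]
  have h2 : Integrable (fun t => ‖hg'.toLp g t‖ ^ 2) AddCircle.haarAddCircle :=
    (memLp_two_iff_integrable_sq_norm (Lp.aestronglyMeasurable _)).1 (Lp.memLp _)
  rw [h1, h.tsum_eq, ofReal_integral_eq_lintegral_ofReal h2
    (Filter.Eventually.of_forall fun _ => by positivity),
    AddCircle.volume_eq_smul_haarAddCircle, lintegral_smul_measure, smul_eq_mul]
  congr 1
  refine lintegral_congr_ae (hae.mono fun x hx => ?_)
  simp only [hx]
  rw [ENNReal.ofReal_pow (norm_nonneg _), ofReal_norm]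

theorem lintegral_sq_trigPoly (S : Finset ℤ) (c : ℤ → ℂ) :
    ∫⁻ x : AddCircle L, ‖∑ k ∈ S, fourier k x * c k‖ₑ ^ 2 =
      ENNReal.ofReal L * ∑ k ∈ S, ‖c k‖ₑ ^ 2 := by
  have hc : Continuous fun x : AddCircle L => ∑ k ∈ S, fourier k x * c k :=
    continuous_finsetSum _ fun k _ => (fourier k).continuous.mul continuous_const
  rw [lintegral_sq_eq_tsum_fourierCoeff
    (hc.memLp_of_hasCompactSupport (HasCompactSupport.of_compactSpace _))]
  simp_rw [fourierCoeff_sum_fourier]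
  rw [tsum_eq_sum (s := S) fun k hk => by simp [hk]]
  congr 1
  exact Finset.sum_congr rfl fun k hk => by rw [if_pos hk]

theorem lintegral_sq_sum_fourier_mul (S : Finset ℤ) {H : ℤ → ℝ → ℂ}
    (hH : ∀ k, Measurable (H k)) :
    ∫⁻ x : ℝ × AddCircle L, ‖∑ k ∈ S, fourier k x.2 * H k x.1‖ₑ ^ 2 =
      ENNReal.ofReal L * ∑ k ∈ S, ∫⁻ x, ‖H k x‖ₑ ^ 2 := by
  have hm : Measurable fun x : ℝ × AddCircle L => ‖∑ k ∈ S, fourier k x.2 * H k x.1‖ₑ ^ 2 := by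
    refine (Finset.measurable_sum _ fun k _ => ?_).enorm.pow_const 2
    exact ((fourier k).continuous.measurable.comp measurable_snd).mul ((hH k).comp measurable_fst)
  rw [Measure.volume_eq_prod, lintegral_prod _ hm.aemeasurable]
  simp_rw [lintegral_sq_trigPoly]
  rw [lintegral_const_mul' _ _ ENNReal.ofReal_ne_top,
    lintegral_finsetSum _ fun k _ => (hH k).enorm.pow_const 2]

/-- Parseval holds on almost every fibre `{x₁} × 𝕋_L`, since by Tonelli almost every fibre is square
integrable. The factor `L` is the total mass of the circle. -/
theorem tsum_lintegral_sq_circleCoeff (φ : L2Cyl L) :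
    ENNReal.ofReal L * ∑' k : ℤ, ∫⁻ x, ‖circleCoeff L k φ x‖ₑ ^ 2 = ∫⁻ x, ‖φ x‖ₑ ^ 2 := by
  have hφ : AEStronglyMeasurable φ ((volume : Measure ℝ).prod (volume : Measure (AddCircle L))) :=
    Lp.aestronglyMeasurable φ
  have hfin : ∫⁻ x₁ : ℝ, ∫⁻ x₂ : AddCircle L, ‖φ (x₁, x₂)‖ₑ ^ 2 < ∞ := by
    rw [← lintegral_prod _ (hφ.enorm.pow_const 2), ← Measure.volume_eq_prod, ← eLpNorm_two_sq]
    exact ENNReal.pow_lt_top (Lp.memLp φ).2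
  have hfib : ∀ᵐ x₁ : ℝ, MemLp (fun x₂ : AddCircle L => φ (x₁, x₂)) 2 volume := by
    have hm := (hφ.enorm.pow_const 2).lintegral_prod_right'
    filter_upwards [hφ.prodMk_left, ae_lt_top' hm hfin.ne] with x₁ h1 h2
    refine ⟨h1, ?_⟩
    rw [← eLpNorm_two_sq] at h2
    exact (ENNReal.pow_lt_top_iff.1 h2).resolve_right (by norm_num)
  have hcoef : ∀ k : ℤ, ∀ᵐ x₁ : ℝ, circleCoeff L k φ x₁ =
      fourierCoeff (fun x₂ : AddCircle L => φ (x₁, x₂)) k := fun k =>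
    (memLp_circleCoeff L k φ).coeFn_toLp.mono fun x₁ h => by
      rw [fourierCoeff_eq_const_mul_integral]
      exact h
  rw [← lintegral_tsum fun k => ((Lp.aestronglyMeasurable _).enorm.pow_const 2),
    ← lintegral_const_mul' _ _ ENNReal.ofReal_ne_top]
  refine Eq.trans ?_ (lintegral_prod _ (hφ.enorm.pow_const 2)).symm
  refine lintegral_congr_ae ?_
  filter_upwards [hfib, ae_all_iff.2 hcoef] with x₁ h1 h2
  rw [lintegral_sq_eq_tsum_fourierCoeff h1]
  simp_rw [h2]

theorem coeFn_sum_mode (S : Finset ℤ) (f : ℤ → Lp ℂ 2 (volume : Measure ℝ)) :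
    (∑ k ∈ S, mode L k (f k) : L2Cyl L) =ᵐ[volume]
      fun x => ∑ k ∈ S, fourier k x.2 * f k x.1 := by
  have h : ∀ᵐ x : ℝ × AddCircle L, ∀ k : ℤ, mode L k (f k) x = fourier k x.2 * f k x.1 :=
    ae_all_iff.2 fun k => (memLp_mode L k (f k)).coeFn_toLp
  filter_upwards [Lp.coeFn_finsetSum S fun k => mode L k (f k), h] with x h1 h2
  rw [h1, Finset.sum_apply]
  exact Finset.sum_congr rfl fun k _ => h2 k

theorem circleCoeff_sum_mode (S : Finset ℤ) (f : ℤ → Lp ℂ 2 (volume : Measure ℝ)) (j : ℤ) :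
    circleCoeff L j (∑ k ∈ S, mode L k (f k)) = if j ∈ S then f j else 0 := by
  refine Lp.ext ?_
  have h1 := Measure.ae_ae_of_ae_prod (μ := (volume : Measure ℝ))
    (ν := (volume : Measure (AddCircle L))) (coeFn_sum_mode (L := L) S f)
  have h2 : (if j ∈ S then f j else 0 : Lp ℂ 2 (volume : Measure ℝ)) =ᵐ[volume]
      fun x => if j ∈ S then f j x else 0 := by
    split_ifs
    · rfl
    · exact Lp.coeFn_zero _ _ _
  filter_upwards [(memLp_circleCoeff L j (∑ k ∈ S, mode L k (f k))).coeFn_toLp,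
    h1, h2] with x₁ h3 h4 h5
  rw [h5, ← fourierCoeff_sum_fourier (L := L) S (fun k => f k x₁) j,
    fourierCoeff_eq_const_mul_integral]
  refine h3.trans ?_
  congr 1
  exact integral_congr_ae (h4.mono fun x₂ h => by simp only [h])

theorem fourierInv_zero_L2 : 𝓕⁻ (0 : Lp ℂ 2 (volume : Measure ℝ)) = 0 :=
  (Lp.fourierTransformₗᵢ ℝ ℂ).symm.map_zero

theorem fourier_zero_L2 : 𝓕 (0 : Lp ℂ 2 (volume : Measure ℝ)) = 0 :=
  (Lp.fourierTransformₗᵢ ℝ ℂ).map_zero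

theorem mode_zero (k : ℤ) : mode L k 0 = 0 := by
  refine Lp.ext ?_
  have h0 : ∀ᵐ x : ℝ × AddCircle L, (0 : Lp ℂ 2 (volume : Measure ℝ)) x.1 = 0 :=
    Measure.quasiMeasurePreserving_fst.ae (Lp.coeFn_zero ℂ 2 (volume : Measure ℝ))
  filter_upwards [(memLp_mode L k 0).coeFn_toLp, h0, Lp.coeFn_zero ℂ 2 volume] with x h1 h2 h3
  rw [h3]
  refine h1.trans ?_
  rw [h2, mul_zero]
  rfl

theorem symbolMul_zero (m : FourierSymbol) (ξ₂ : ℝ) : symbolMul m ξ₂ 0 = 0 := by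
  refine Lp.ext ?_
  filter_upwards [(memLp_symbolMul m ξ₂ 0).coeFn_toLp, Lp.coeFn_zero ℂ 2 (volume : Measure ℝ)]
    with x h1 h2
  rw [h2]
  refine h1.trans ?_
  rw [h2, Pi.zero_apply, mul_zero]

theorem symbolMul_eq_zero {m : FourierSymbol} {ξ₂ : ℝ} (hm : ∀ ξ₁, m.toFun ξ₁ ξ₂ = 0)
    (g : Lp ℂ 2 (volume : Measure ℝ)) : symbolMul m ξ₂ g = 0 := by
  refine Lp.ext ?_
  filter_upwards [(memLp_symbolMul m ξ₂ g).coeFn_toLp, Lp.coeFn_zero ℂ 2 (volume : Measure ℝ)]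
    with x h1 h2
  rw [h2]
  refine h1.trans ?_
  rw [hm, zero_mul]
  rfl

/-- All terms outside `S` vanish, so convergence of the series in `L²` is never at issue. -/
theorem fourierMultiplier_eq_sum {m : FourierSymbol} {S : Finset ℤ}
    (hm : ∀ k ∉ S, ∀ ξ₁, m.toFun ξ₁ (k / L) = 0) (φ : L2Cyl L) :
    fourierMultiplier L m φ =
      ∑ k ∈ S, mode L k (𝓕⁻ (symbolMul m (k / L) (𝓕 (circleCoeff L k φ)))) :=
  tsum_eq_sum fun k hk => by
    rw [symbolMul_eq_zero (hm k hk), fourierInv_zero_L2, mode_zero]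

theorem fourierMultiplier_sum_mode (m : FourierSymbol) (S : Finset ℤ)
    (f : ℤ → Lp ℂ 2 (volume : Measure ℝ)) :
    fourierMultiplier L m (∑ k ∈ S, mode L k (f k)) =
      ∑ k ∈ S, mode L k (𝓕⁻ (symbolMul m (k / L) (𝓕 (f k)))) := by
  rw [fourierMultiplier, tsum_eq_sum (s := S) fun k hk => by
    rw [circleCoeff_sum_mode, if_neg hk, fourier_zero_L2, symbolMul_zero, fourierInv_zero_L2,
      mode_zero]]
  exact Finset.sum_congr rfl fun k hk => by rw [circleCoeff_sum_mode, if_pos hk]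

theorem integrable_of_memLp_two_of_support {a : ℝ → ℂ} (ha : MemLp a 2 volume) {ρ : ℝ}
    (hρ : ∀ ξ, a ξ ≠ 0 → |ξ| ≤ ρ) : Integrable a := by
  rw [← integrableOn_iff_integrable_of_support_subset (s := Set.Icc (-ρ) ρ)
    fun ξ hξ => abs_le.1 (hρ ξ hξ)]
  exact (ha.restrict _).integrable (by norm_num)

/-- The evolution of a frequency-localised datum is a finite sum of integral Fourier transforms. -/
theorem hyperbolicFlow_fourierMultiplier_ae_eq {m : FourierSymbol} {S : Finset ℤ} {ρ : ℝ}
    (hm : ∀ k ∉ S, ∀ ξ₁, m.toFun ξ₁ (k / L) = 0)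
    (hρ : ∀ ξ₁ ξ₂, m.toFun ξ₁ ξ₂ ≠ 0 → |ξ₁| ≤ ρ) (t : ℝ) (φ : L2Cyl L) :
    hyperbolicFlow L t (fourierMultiplier L m φ) =ᵐ[volume] fun x => ∑ k ∈ S, fourier k x.2 *
      𝓕⁻ (fun ξ => (hyperbolicSymbol t).toFun ξ (k / L) *
        (m.toFun ξ (k / L) * 𝓕 (circleCoeff L k φ) ξ)) x.1 := by
  rw [fourierMultiplier_eq_sum hm, hyperbolicFlow, fourierMultiplier_sum_mode]
  refine (coeFn_sum_mode S _).trans ?_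
  have h : ∀ k : ℤ, (𝓕⁻ (symbolMul (hyperbolicSymbol t) (k / L)
      (𝓕 (𝓕⁻ (symbolMul m (k / L) (𝓕 (circleCoeff L k φ)))))) : Lp ℂ 2 (volume : Measure ℝ))
      =ᵐ[volume] 𝓕⁻ (fun ξ => (hyperbolicSymbol t).toFun ξ (k / L) *
        (m.toFun ξ (k / L) * 𝓕 (circleCoeff L k φ) ξ)) := by
    intro k
    rw [FourierTransform.fourier_fourierInv_eq]
    have hae : (symbolMul (hyperbolicSymbol t) (k / L)
        (symbolMul m (k / L) (𝓕 (circleCoeff L k φ)))) =ᵐ[volume]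
        (fun ξ => (hyperbolicSymbol t).toFun ξ (k / L) *
          (m.toFun ξ (k / L) * 𝓕 (circleCoeff L k φ) ξ)) := by
      filter_upwards [(memLp_symbolMul (hyperbolicSymbol t) (k / L)
        (symbolMul m (k / L) (𝓕 (circleCoeff L k φ)))).coeFn_toLp,
        (memLp_symbolMul m (k / L) (𝓕 (circleCoeff L k φ))).coeFn_toLp] with ξ h1 h2
      refine h1.trans ?_
      congr 1
    -- Bounded frequency support upgrades `L²` to `L¹`, so the inverse transform is an integral.
    refine fourierInv_L2_ae_eq (integrable_of_memLp_two_of_support (ρ := ρ)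
      ((memLp_congr_ae hae).1 (Lp.memLp _)) fun ξ hξ => hρ ξ (k / L) fun h0 => hξ ?_) hae
    rw [h0, zero_mul, mul_zero]
  have h' : ∀ᵐ x : ℝ × AddCircle L, ∀ k : ℤ, (𝓕⁻ (symbolMul (hyperbolicSymbol t) (k / L)
      (𝓕 (𝓕⁻ (symbolMul m (k / L) (𝓕 (circleCoeff L k φ)))))) : Lp ℂ 2 (volume : Measure ℝ)) x.1 =
      𝓕⁻ (fun ξ => (hyperbolicSymbol t).toFun ξ (k / L) *
        (m.toFun ξ (k / L) * 𝓕 (circleCoeff L k φ) ξ)) x.1 :=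
    ae_all_iff.2 fun k => Measure.quasiMeasurePreserving_fst.ae (h k)
  filter_upwards [h'] with x hx
  exact Finset.sum_congr rfl fun k _ => by rw [hx k]

end Circle

/-! ### Fourier coefficients of the product of two evolutions -/

theorem fourierInv_finset_sum {ι : Type*} (s : Finset ι) {f : ι → ℝ → ℂ}
    (hf : ∀ i ∈ s, Integrable (f i)) (x : ℝ) :
    𝓕⁻ (fun ξ => ∑ i ∈ s, f i ξ) x = ∑ i ∈ s, 𝓕⁻ (f i) x := by
  simp only [Real.fourierInv_eq_fourier_neg, Real.fourier_eq]
  simp_rw [Finset.smul_sum]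
  exact integral_finsetSum _ fun i hi => (Real.fourierIntegral_convergent_iff (-x)).2 (hf i hi)

theorem measurable_fourierInv {f : ℝ → ℂ} (hf : Integrable f) : Measurable (𝓕⁻ f) := by
  have : 𝓕⁻ f = fun x => 𝓕 f (-x) := funext fun x => Real.fourierInv_eq_fourier_neg f x
  rw [this]
  exact ((VectorFourier.fourierIntegral_continuous Real.continuous_fourierChar
    (by fun_prop) hf).comp continuous_neg).measurable

/-- The function `(l, η) ↦ b(η, l) a(ξ - η, n - l)` whose integral is the convolution of `a` and
`b` at the frequency `(ξ, n)`. -/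
def convIntegrand (a b : ℤ → ℝ → ℂ) (n : ℤ) (ξ : ℝ) (y : ℤ × ℝ) : ℂ :=
  b y.1 y.2 * a (n - y.1) (ξ - y.2)

/-- The time frequency of the product of the plane waves with frequencies `(η, l / L)` and
`(ξ - η, (n - l) / L)`. -/
noncomputable def productPhase (L : ℝ) (n : ℤ) (ξ : ℝ) (y : ℤ × ℝ) : ℝ :=
  4 * Real.pi ^ 2 * ((y.2 ^ 2 - (y.1 / L) ^ 2) +
    ((ξ - y.2) ^ 2 - (((n - y.1 : ℤ) : ℝ) / L) ^ 2))

/-- The Fourier transform in space of the product of two evolutions, at time `t` and frequency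
`(ξ, n / L)`. -/
noncomputable def productCoeff (L : ℝ) (a b : ℤ → ℝ → ℂ) (n : ℤ) (t ξ : ℝ) : ℂ :=
  ∫ y, convIntegrand a b n ξ y * Complex.exp ((-(productPhase L n ξ y * t) : ℝ) * Complex.I)
    ∂(Measure.count.prod volume)

/-- Completing the square, `η² + (ξ - η)² = 2(η - ξ/2)² + ξ²/2`, and likewise in the periodic
variable; the constants cancel in the difference. -/
theorem productPhase_sub (L : ℝ) (n : ℤ) (ξ : ℝ) (y y' : ℤ × ℝ) :
    productPhase L n ξ y - productPhase L n ξ y' =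
      8 * Real.pi ^ 2 * (resonance L n ξ y - resonance L n ξ y') := by
  have h : ∀ z : ℤ × ℝ, productPhase L n ξ z =
      4 * Real.pi ^ 2 * (2 * resonance L n ξ z + (ξ ^ 2 / 2 - 2 * (n / (2 * L)) ^ 2)) := by
    intro z
    simp only [productPhase, resonance]
    push_cast
    ring
  rw [h, h]
  ring

theorem exp_neg_productPhase_le (L : ℝ) (n : ℤ) (ξ : ℝ) (y y' : ℤ × ℝ) :
    Real.exp (-((productPhase L n ξ y - productPhase L n ξ y') ^ 2 / 4)) ≤
      Real.exp (-(resonance L n ξ y' - resonance L n ξ y) ^ 2) := by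
  rw [productPhase_sub]
  refine Real.exp_le_exp.2 (neg_le_neg ?_)
  have h1 : 1 ≤ 2 * Real.pi ^ 2 := by nlinarith [Real.pi_gt_three]
  have h2 : 1 ≤ (2 * Real.pi ^ 2) ^ 2 := one_le_pow₀ h1
  nlinarith [sq_nonneg (resonance L n ξ y' - resonance L n ξ y)]

theorem measurable_productPhase (L : ℝ) (n : ℤ) :
    Measurable fun p : ℝ × (ℤ × ℝ) => productPhase L n p.1 p.2 := by
  have h1 : Measurable fun p : ℝ × (ℤ × ℝ) => (p.2.1 : ℝ) :=
    (measurable_from_top (f := fun l : ℤ => (l : ℝ))).comp (by fun_prop)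
  have h2 : Measurable fun p : ℝ × (ℤ × ℝ) => ((n - p.2.1 : ℤ) : ℝ) :=
    (measurable_from_top (f := fun l : ℤ => ((n - l : ℤ) : ℝ))).comp (by fun_prop)
  unfold productPhase
  fun_prop

section Product

variable {a b : ℤ → ℝ → ℂ}

theorem measurable_convIntegrand
    (ha : ∀ k, Measurable (a k)) (hb : ∀ k, Measurable (b k))
    (n : ℤ) :
    Measurable fun p : ℝ × (ℤ × ℝ) => convIntegrand a b n p.1 p.2 := by
  have h1 : Measurable (Function.uncurry a) := measurable_from_prod_countable_right ha
  have h2 : Measurable (Function.uncurry b) := measurable_from_prod_countable_right hb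
  have h3 : Measurable fun p : ℝ × (ℤ × ℝ) => (n - p.2.1, p.1 - p.2.2) := by fun_prop
  exact (h2.comp measurable_snd).mul (h1.comp h3)

theorem measurable_productCoeff
    (ha : ∀ k, Measurable (a k)) (hb : ∀ k, Measurable (b k))
    (L : ℝ) (n : ℤ) :
    Measurable fun p : ℝ × ℝ => productCoeff L a b n p.1 p.2 := by
  have h1 : Measurable fun p : (ℝ × ℝ) × (ℤ × ℝ) => convIntegrand a b n p.1.2 p.2 :=
    (measurable_convIntegrand ha hb n).comp
      (by fun_prop : Measurable fun p : (ℝ × ℝ) × (ℤ × ℝ) => (p.1.2, p.2))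
  have h2 : Measurable fun p : (ℝ × ℝ) × (ℤ × ℝ) => productPhase L n p.1.2 p.2 :=
    (measurable_productPhase L n).comp
      (by fun_prop : Measurable fun p : (ℝ × ℝ) × (ℤ × ℝ) => (p.1.2, p.2))
  have h3 : Measurable fun p : (ℝ × ℝ) × (ℤ × ℝ) => convIntegrand a b n p.1.2 p.2 *
      Complex.exp ((-(productPhase L n p.1.2 p.2 * p.1.1) : ℝ) * Complex.I) := by fun_prop
  exact (h3.stronglyMeasurable.integral_prod_right' (ν := Measure.count.prod volume)).measurable

theorem lintegral_sq_convIntegrand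
    (ha : ∀ k, Measurable (a k)) (hb : ∀ k, Measurable (b k))
    (n : ℤ) :
    ∫⁻ ξ, ∫⁻ y, ‖convIntegrand a b n ξ y‖ₑ ^ 2 ∂(Measure.count.prod volume) =
      ∑' l : ℤ, (∫⁻ η, ‖b l η‖ₑ ^ 2) * ∫⁻ ξ, ‖a (n - l) ξ‖ₑ ^ 2 := by
  have hm := measurable_convIntegrand ha hb n
  have hmξ : ∀ ξ, Measurable fun y => convIntegrand a b n ξ y := fun ξ =>
    hm.comp measurable_prodMk_left
  have e1 : ∀ ξ, ∫⁻ y, ‖convIntegrand a b n ξ y‖ₑ ^ 2 ∂(Measure.count.prod volume) =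
      ∑' l : ℤ, ∫⁻ η, ‖b l η‖ₑ ^ 2 * ‖a (n - l) (ξ - η)‖ₑ ^ 2 := by
    intro ξ
    rw [lintegral_prod _ ((hmξ ξ).enorm.pow_const 2).aemeasurable, lintegral_count]
    simp only [convIntegrand, enorm_mul, mul_pow]
  simp_rw [e1]
  have hml : ∀ l : ℤ, Measurable fun p : ℝ × ℝ => ‖b l p.2‖ₑ ^ 2 * ‖a (n - l) (p.1 - p.2)‖ₑ ^ 2 :=
    fun l => by
      have h1 : Measurable fun p : ℝ × ℝ => b l p.2 := (hb l).comp measurable_snd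
      have h2 : Measurable fun p : ℝ × ℝ => a (n - l) (p.1 - p.2) :=
        (ha (n - l)).comp (by fun_prop)
      exact (h1.enorm.pow_const 2).mul (h2.enorm.pow_const 2)
  rw [lintegral_tsum fun l => (hml l).lintegral_prod_right'.aemeasurable]
  refine tsum_congr fun l => ?_
  rw [lintegral_lintegral_swap (hml l).aemeasurable]
  have e2 : ∀ η, ∫⁻ ξ, ‖b l η‖ₑ ^ 2 * ‖a (n - l) (ξ - η)‖ₑ ^ 2 =
      ‖b l η‖ₑ ^ 2 * ∫⁻ ξ, ‖a (n - l) ξ‖ₑ ^ 2 := by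
    intro η
    rw [lintegral_const_mul' _ _ (by simp),
      lintegral_sub_right_eq_self (fun ξ => ‖a (n - l) ξ‖ₑ ^ 2) η]
  simp_rw [e2]
  rw [lintegral_mul_const _ ((hb l).enorm.pow_const 2)]

/-- Tonelli and translation invariance in `ξ` and in `n`: the convolution of `|a|²` and `|b|²` has
total mass the product of theirs. -/
theorem tsum_lintegral_sq_convIntegrand
    (ha : ∀ k, Measurable (a k)) (hb : ∀ k, Measurable (b k)) :
    ∑' n : ℤ, ∫⁻ ξ, ∫⁻ y, ‖convIntegrand a b n ξ y‖ₑ ^ 2 ∂(Measure.count.prod volume) =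
      (∑' k : ℤ, ∫⁻ ξ, ‖a k ξ‖ₑ ^ 2) * ∑' l : ℤ, ∫⁻ η, ‖b l η‖ₑ ^ 2 := by
  simp_rw [lintegral_sq_convIntegrand ha hb]
  rw [ENNReal.tsum_comm, ← ENNReal.tsum_mul_left]
  refine tsum_congr fun l => ?_
  rw [ENNReal.tsum_mul_left, mul_comm]
  congr 1
  exact (Equiv.subRight l).tsum_eq fun k => ∫⁻ ξ, ‖a k ξ‖ₑ ^ 2

/-- Each slice is a product of two `L²` functions, and only finitely many `l` contribute. -/
theorem integrable_convIntegrand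
    (ha : ∀ k, Measurable (a k)) (hb : ∀ k, Measurable (b k))
    (ha2 : ∀ k, MemLp (a k) 2 volume) (hb2 : ∀ k, MemLp (b k) 2 volume)
    {T : Finset ℤ} (hT : ∀ k ∉ T, b k = 0)
    (n : ℤ) (ξ : ℝ) :
    Integrable (convIntegrand a b n ξ) (Measure.count.prod volume) := by
  have hm : Measurable fun y => convIntegrand a b n ξ y :=
    (measurable_convIntegrand ha hb n).comp measurable_prodMk_left
  refine (integrable_prod_iff hm.aestronglyMeasurable).2
    ⟨Filter.Eventually.of_forall fun l => ?_, ?_⟩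
  · have h : MemLp (fun η => a (n - l) (ξ - η)) 2 volume :=
      (ha2 (n - l)).comp_measurePreserving (Measure.measurePreserving_sub_left volume ξ)
    exact (hb2 l).integrable_mul h
  · rw [integrable_count_iff]
    refine summable_of_hasFiniteSupport (T.finite_toSet.subset fun l hl => ?_)
    by_contra h
    refine hl ?_
    simp only [convIntegrand, hT l h, Pi.zero_apply, zero_mul, norm_zero, integral_zero]

theorem productCoeff_eq_sum
    (ha : ∀ k, Measurable (a k)) (hb : ∀ k, Measurable (b k))
    (ha2 : ∀ k, MemLp (a k) 2 volume) (hb2 : ∀ k, MemLp (b k) 2 volume)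
    {T : Finset ℤ} (hT : ∀ k ∉ T, b k = 0)
    (L : ℝ) (n : ℤ) (t ξ : ℝ) :
    productCoeff L a b n t ξ = ∑ l ∈ T, ∫ η,
      ((hyperbolicSymbol t).toFun η (l / L) * b l η) *
        ((hyperbolicSymbol t).toFun (ξ - η) ((n - l : ℤ) / L) * a (n - l) (ξ - η)) := by
  have hi := integrable_convIntegrand ha hb ha2 hb2 hT n ξ
  have hp : Measurable fun y => productPhase L n ξ y :=
    (measurable_productPhase L n).comp measurable_prodMk_left
  have hi' : Integrable (fun y => convIntegrand a b n ξ y *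
      Complex.exp ((-(productPhase L n ξ y * t) : ℝ) * Complex.I))
      (Measure.count.prod volume) := by
    refine hi.mono (hi.1.mul (Measurable.aestronglyMeasurable (by fun_prop)))
      (Filter.Eventually.of_forall fun y => ?_)
    rw [norm_mul, Complex.norm_exp_ofReal_mul_I, mul_one]
  rw [productCoeff, integral_prod _ hi', integral_countable hi'.integral_prod_left,
    tsum_eq_sum (s := T) fun l hl => ?_]
  · refine Finset.sum_congr rfl fun l _ => ?_
    simp only [Measure.real, Measure.count_singleton, ENNReal.toReal_one, one_smul]
    refine integral_congr_ae (Filter.Eventually.of_forall fun η => ?_)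
    simp only [convIntegrand, hyperbolicSymbol, productPhase]
    have e : ∀ u v : ℝ, Complex.exp ((-((4 * Real.pi ^ 2 * (u + v)) * t) : ℝ) * Complex.I) =
        Complex.exp ((-(4 * Real.pi ^ 2 * t * u) : ℝ) * Complex.I) *
          Complex.exp ((-(4 * Real.pi ^ 2 * t * v) : ℝ) * Complex.I) := by
      intro u v
      rw [← Complex.exp_add]
      congr 1
      push_cast
      ring
    rw [e]
    ring
  · simp [convIntegrand, hT l hl]

/-- The square function estimate in time, at a fixed frequency of the product. -/
theorem lintegral_sq_productCoeff_le
    (ha : ∀ k, Measurable (a k)) (hb : ∀ k, Measurable (b k))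
    (ha2 : ∀ k, MemLp (a k) 2 volume) (hb2 : ∀ k, MemLp (b k) 2 volume)
    {T : Finset ℤ} (hT : ∀ k ∉ T, b k = 0)
    {L ρ M : ℝ} (hL : 1 ≤ L) (hρ : 1 ≤ ρ) (hM : 0 < M)
    (hρM : ρ ≤ 4 * M) (hbs : ∀ l η, b l η ≠ 0 → η ^ 2 + (l / L) ^ 2 ≤ ρ ^ 2)
    (has : ∀ k ξ, a k ξ ≠ 0 → (8 * M) ^ 2 ≤ ξ ^ 2 + (k / L) ^ 2) (n : ℤ) (ξ : ℝ) :
    ∫⁻ t in Set.Icc (0 : ℝ) 1, ‖productCoeff L a b n t ξ‖ₑ ^ 2 ≤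
      ENNReal.ofReal (Real.exp 1 * √Real.pi) *
        ((∑' m : ℤ, ENNReal.ofReal (4 / (1 + (m : ℝ) ^ 2))) *
          ENNReal.ofReal (140 * (1 + ρ * L / M))) *
        ∫⁻ y, ‖convIntegrand a b n ξ y‖ₑ ^ 2 ∂(Measure.count.prod volume) := by
  refine lintegral_sq_oscillatory_le (integrable_convIntegrand ha hb ha2 hb2 hT n ξ)
    ((measurable_convIntegrand ha hb n).comp measurable_prodMk_left)
    ((measurable_productPhase L n).comp measurable_prodMk_left)
    (S := separatedFreq L ρ M n ξ) (fun y hy => ?_) (measurableSet_separatedFreq L ρ M n ξ)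
    fun y _ => ?_
  · exact ⟨hbs _ _ (left_ne_zero_of_mul hy), has _ _ (right_ne_zero_of_mul hy)⟩
  -- The window is centred at the resonance of the frozen point `y`; uniformity in the centre makes
  -- the Schur bound independent of `y`.
  · refine le_trans (lintegral_mono fun y' => ?_)
      (lintegral_exp_neg_resonance_le hL hρ hM hρM n ξ (resonance L n ξ y))
    exact ENNReal.ofReal_le_ofReal (exp_neg_productPhase_le L n ξ y y')

end Product

/-! ### The bilinear estimate for finitely many modes -/

/-- The Fourier side of `e^{it□}`, mode by mode. -/
noncomputable def evolvedMode (L t : ℝ) (a : ℤ → ℝ → ℂ) (k : ℤ) (ξ : ℝ) : ℂ :=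
  (hyperbolicSymbol t).toFun ξ (k / L) * a k ξ

/-- The evolution `e^{it□}` of the function with Fourier coefficients `a k`, `k ∈ S`. -/
noncomputable def evolution (L : ℝ) (S : Finset ℤ) (a : ℤ → ℝ → ℂ) (t : ℝ)
    (x : ℝ × AddCircle L) : ℂ :=
  ∑ k ∈ S, fourier k x.2 * 𝓕⁻ (evolvedMode L t a k) x.1

theorem integrable_evolvedMode {a : ℤ → ℝ → ℂ} {k : ℤ} (ha : Integrable (a k)) (L t : ℝ) :
    Integrable (evolvedMode L t a k) := by
  have hm : Measurable fun ξ : ℝ => (hyperbolicSymbol t).toFun ξ (k / L) :=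
    (hyperbolicSymbol t).measurable.comp (f := fun ξ : ℝ => (ξ, (k : ℝ) / L)) (by fun_prop)
  refine ha.mono (hm.aestronglyMeasurable.mul ha.1) (Filter.Eventually.of_forall fun ξ => ?_)
  rw [evolvedMode, norm_mul]
  simp only [hyperbolicSymbol]
  rw [Complex.norm_exp_ofReal_mul_I, one_mul]

section Product

variable {a b : ℤ → ℝ → ℂ}

theorem fourierInv_productCoeff (ha : ∀ k, Measurable (a k)) (hb : ∀ k, Measurable (b k))
    (ha2 : ∀ k, MemLp (a k) 2 volume) (hb2 : ∀ k, MemLp (b k) 2 volume)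
    (ha1 : ∀ k, Integrable (a k)) (hb1 : ∀ k, Integrable (b k))
    {T : Finset ℤ} (hT : ∀ k ∉ T, b k = 0) (L : ℝ) (n : ℤ) (t : ℝ) :
    Integrable (productCoeff L a b n t) ∧ ∀ x, 𝓕⁻ (productCoeff L a b n t) x =
      ∑ l ∈ T, 𝓕⁻ (evolvedMode L t b l) x * 𝓕⁻ (evolvedMode L t a (n - l)) x := by
  have e : productCoeff L a b n t = fun ξ => ∑ l ∈ T, ∫ η,
      evolvedMode L t b l η * evolvedMode L t a (n - l) (ξ - η) :=
    funext fun ξ => productCoeff_eq_sum ha hb ha2 hb2 hT L n t ξ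
  have hi : ∀ l ∈ T, Integrable fun ξ => ∫ η,
      evolvedMode L t b l η * evolvedMode L t a (n - l) (ξ - η) := fun l _ =>
    integrable_conv (integrable_evolvedMode (hb1 l) L t) (integrable_evolvedMode (ha1 _) L t)
  rw [e]
  refine ⟨integrable_finsetSum _ hi, fun x => ?_⟩
  rw [fourierInv_finset_sum T hi]
  exact Finset.sum_congr rfl fun l _ => (fourierInv_mul_fourierInv
    (integrable_evolvedMode (hb1 l) L t) (integrable_evolvedMode (ha1 _) L t) x).symm

theorem evolution_mul_evolution (ha : ∀ k, Measurable (a k)) (hb : ∀ k, Measurable (b k))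
    (ha2 : ∀ k, MemLp (a k) 2 volume) (hb2 : ∀ k, MemLp (b k) 2 volume)
    (ha1 : ∀ k, Integrable (a k)) (hb1 : ∀ k, Integrable (b k))
    {S T : Finset ℤ} (hS : ∀ k ∉ S, a k = 0) (hT : ∀ k ∉ T, b k = 0) (L t : ℝ)
    (x : ℝ × AddCircle L) :
    evolution L S a t x * evolution L T b t x =
      ∑ n ∈ Finset.image₂ (· + ·) S T, fourier n x.2 * 𝓕⁻ (productCoeff L a b n t) x.1 := by
  classical
  simp_rw [(fourierInv_productCoeff ha hb ha2 hb2 ha1 hb1 hT L _ t).2, Finset.mul_sum]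
  rw [Finset.sum_comm, evolution, evolution, mul_comm, Finset.sum_mul]
  refine Finset.sum_congr rfl fun l hl => ?_
  -- For fixed `l`, only `n ∈ S + l` contributes to the sum over `S + T`, because `a (n - l)`
  -- vanishes otherwise.
  have hsub : S.image (· + l) ⊆ Finset.image₂ (· + ·) S T := by
    intro n hn
    obtain ⟨k, hk, rfl⟩ := Finset.mem_image.1 hn
    exact Finset.mem_image₂_of_mem hk hl
  rw [← Finset.sum_subset hsub fun n _ hn => ?_,
    Finset.sum_image fun _ _ _ _ h => add_right_cancel h, Finset.mul_sum]
  · refine Finset.sum_congr rfl fun k _ => ?_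
    rw [add_sub_cancel_right, fourier_add]
    ring
  · have h0 : a (n - l) = 0 := hS _ fun h =>
      hn (Finset.mem_image.2 ⟨n - l, h, sub_add_cancel n l⟩)
    have h1 : evolvedMode L t a (n - l) = 0 := by
      ext ξ
      simp [evolvedMode, h0]
    have h2 : 𝓕⁻ (0 : ℝ → ℂ) x.1 = 0 := by simp [Real.fourierInv_eq]
    rw [h1, h2, mul_zero, mul_zero]

/-- The bilinear estimate for evolutions with finitely many modes in the periodic variable. -/
theorem lintegral_sq_evolution_mul_le (ha : ∀ k, Measurable (a k)) (hb : ∀ k, Measurable (b k))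
    (ha2 : ∀ k, MemLp (a k) 2 volume) (hb2 : ∀ k, MemLp (b k) 2 volume)
    (ha1 : ∀ k, Integrable (a k)) (hb1 : ∀ k, Integrable (b k))
    {S T : Finset ℤ} (hS : ∀ k ∉ S, a k = 0) (hT : ∀ k ∉ T, b k = 0)
    {L ρ M : ℝ} [Fact (0 < L)] (hL : 1 ≤ L) (hρ : 1 ≤ ρ) (hM : 0 < M)
    (hρM : ρ ≤ 4 * M) (hbs : ∀ l η, b l η ≠ 0 → η ^ 2 + (l / L) ^ 2 ≤ ρ ^ 2)
    (has : ∀ k ξ, a k ξ ≠ 0 → (8 * M) ^ 2 ≤ ξ ^ 2 + (k / L) ^ 2) :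
    ∫⁻ t in Set.Icc (0 : ℝ) 1, ∫⁻ x, ‖evolution L S a t x * evolution L T b t x‖ₑ ^ 2 ≤
      ENNReal.ofReal L * (ENNReal.ofReal (Real.exp 1 * √Real.pi) *
        ((∑' m : ℤ, ENNReal.ofReal (4 / (1 + (m : ℝ) ^ 2))) *
          ENNReal.ofReal (140 * (1 + ρ * L / M))) *
        ((∑' k : ℤ, ∫⁻ ξ, ‖a k ξ‖ₑ ^ 2) * ∑' l : ℤ, ∫⁻ η, ‖b l η‖ₑ ^ 2)) := by
  classical
  set U := Finset.image₂ (· + ·) S T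
  set D := ENNReal.ofReal (Real.exp 1 * √Real.pi) *
    ((∑' m : ℤ, ENNReal.ofReal (4 / (1 + (m : ℝ) ^ 2))) *
      ENNReal.ofReal (140 * (1 + ρ * L / M)))
  have hi := fun n t => (fourierInv_productCoeff ha hb ha2 hb2 ha1 hb1 hT L n t).1
  have hm : ∀ n, Measurable fun p : ℝ × ℝ => ‖productCoeff L a b n p.1 p.2‖ₑ ^ 2 := fun n =>
    (measurable_productCoeff ha hb L n).enorm.pow_const 2
  have hfix : ∀ t, ∫⁻ x, ‖evolution L S a t x * evolution L T b t x‖ₑ ^ 2 ≤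
      ENNReal.ofReal L * ∑ n ∈ U, ∫⁻ ξ, ‖productCoeff L a b n t ξ‖ₑ ^ 2 := by
    intro t
    simp_rw [evolution_mul_evolution ha hb ha2 hb2 ha1 hb1 hS hT L t]
    rw [lintegral_sq_sum_fourier_mul U fun n => measurable_fourierInv (hi n t)]
    refine mul_le_mul' le_rfl (Finset.sum_le_sum fun n _ => ?_)
    -- Plancherel in `x₁` after Parseval in `x₂` leaves an integral over frequency, so the time
    -- integral can be done first at each fixed `(ξ, n)`.
    rw [← eLpNorm_two_sq, ← eLpNorm_two_sq]
    exact pow_le_pow_left' (eLpNorm_fourierInv_le (hi n t)) 2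
  calc _ ≤ ∫⁻ t in Set.Icc (0 : ℝ) 1,
          ENNReal.ofReal L * ∑ n ∈ U, ∫⁻ ξ, ‖productCoeff L a b n t ξ‖ₑ ^ 2 :=
        lintegral_mono fun t => hfix t
    _ = ENNReal.ofReal L * ∑ n ∈ U, ∫⁻ ξ, ∫⁻ t in Set.Icc (0 : ℝ) 1,
          ‖productCoeff L a b n t ξ‖ₑ ^ 2 := by
        rw [lintegral_const_mul' _ _ ENNReal.ofReal_ne_top,
          lintegral_finsetSum _ fun n _ => (hm n).lintegral_prod_right']
        congr 1
        exact Finset.sum_congr rfl fun n _ => lintegral_lintegral_swap (hm n).aemeasurable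
    _ ≤ ENNReal.ofReal L * ∑ n ∈ U, D * ∫⁻ ξ, ∫⁻ y, ‖convIntegrand a b n ξ y‖ₑ ^ 2
          ∂(Measure.count.prod volume) := by
        gcongr with n
        have hmc : Measurable fun ξ => ∫⁻ y, ‖convIntegrand a b n ξ y‖ₑ ^ 2
            ∂(Measure.count.prod volume) :=
          ((measurable_convIntegrand ha hb n).enorm.pow_const 2).lintegral_prod_right'
        rw [← lintegral_const_mul _ hmc]
        exact lintegral_mono fun ξ => lintegral_sq_productCoeff_le ha hb ha2 hb2 hT hL hρ hM hρM
          hbs has n ξ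
    _ ≤ _ := by
        rw [← Finset.mul_sum]
        gcongr
        exact (ENNReal.sum_le_tsum U).trans_eq (tsum_lintegral_sq_convIntegrand ha hb)

end Product

/-! ### Supports of the Littlewood–Paley symbols -/

/-- The symbol of the Littlewood-Paley projection `P_N`. -/
noncomputable def LittlewoodPaleyCutoff.symbol (ψ : LittlewoodPaleyCutoff) (N : ℕ) :
    FourierSymbol :=
  if N = 1 then ψ.low else ψ.shell.dilate N

namespace LittlewoodPaleyCutoff

variable (ψ : LittlewoodPaleyCutoff)

theorem exists_symbol_bound : ∃ B : ℝ, ∀ N ξ₁ ξ₂, ‖(ψ.symbol N).toFun ξ₁ ξ₂‖ ≤ B := by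
  obtain ⟨B₁, h1⟩ := ψ.low.bounded
  obtain ⟨B₂, h2⟩ := ψ.shell.bounded
  refine ⟨max B₁ B₂, fun N ξ₁ ξ₂ => ?_⟩
  unfold symbol
  split_ifs
  · exact (h1 _ _).trans (le_max_left _ _)
  · exact (h2 _ _).trans (le_max_right _ _)

theorem sqrt_div_natCast (N : ℕ) (ξ₁ ξ₂ : ℝ) :
    √((ξ₁ / N) ^ 2 + (ξ₂ / N) ^ 2) = √(ξ₁ ^ 2 + ξ₂ ^ 2) / N := by
  rw [div_pow, div_pow, ← add_div, Real.sqrt_div (by positivity),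
    Real.sqrt_sq (Nat.cast_nonneg N)]

theorem symbol_support_le {N : ℕ} (hN : 1 ≤ N) {ξ₁ ξ₂ : ℝ}
    (h : (ψ.symbol N).toFun ξ₁ ξ₂ ≠ 0) : ξ₁ ^ 2 + ξ₂ ^ 2 ≤ (max ψ.R 1 * N) ^ 2 := by
  have hN0 : (0 : ℝ) < N := by exact_mod_cast hN
  refine (Real.sqrt_le_left (by positivity)).1 ?_
  unfold symbol at h
  split_ifs at h with h1
  · rw [h1, Nat.cast_one, mul_one]
    exact (ψ.low_support _ _ h).trans (le_max_left _ _)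
  · have h2 := (ψ.shell_support _ _ h).2
    rw [sqrt_div_natCast, div_le_iff₀ hN0] at h2
    exact h2.trans (by gcongr; exact le_max_left _ _)

theorem le_symbol_support {N : ℕ} (hN : 2 ≤ N) {ξ₁ ξ₂ : ℝ}
    (h : (ψ.symbol N).toFun ξ₁ ξ₂ ≠ 0) : (ψ.r * N) ^ 2 ≤ ξ₁ ^ 2 + ξ₂ ^ 2 := by
  have hN0 : (0 : ℝ) < N := by exact_mod_cast (by omega : 0 < N)
  have hr := ψ.r_pos
  refine (Real.le_sqrt' (by positivity)).1 ?_
  unfold symbol at h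
  rw [if_neg (by omega)] at h
  have h2 := (ψ.shell_support _ _ h).1
  rwa [sqrt_div_natCast, le_div_iff₀ hN0] at h2

end LittlewoodPaleyCutoff

/-! ### The bilinear estimate for localised multipliers -/

section Localized

variable (L : ℝ) [Fact (0 < L)]

/-- The Fourier coefficients of the Fourier multiplier operator with symbol `m` applied to `φ`. -/
noncomputable def multiplierMode (m : FourierSymbol) (φ : L2Cyl L) (k : ℤ) (ξ : ℝ) : ℂ :=
  m.toFun ξ (k / L) * 𝓕 (circleCoeff L k φ) ξ

theorem measurable_multiplierMode (m : FourierSymbol) (φ : L2Cyl L) (k : ℤ) :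
    Measurable (multiplierMode L m φ k) := by
  have h : Measurable fun ξ : ℝ => m.toFun ξ (k / L) :=
    m.measurable.comp (f := fun ξ : ℝ => (ξ, (k : ℝ) / L)) (by fun_prop)
  exact h.mul (Lp.stronglyMeasurable _).measurable

theorem memLp_multiplierMode (m : FourierSymbol) (φ : L2Cyl L) (k : ℤ) :
    MemLp (multiplierMode L m φ k) 2 volume :=
  memLp_symbolMul m (k / L) (𝓕 (circleCoeff L k φ))

theorem tsum_lintegral_sq_multiplierMode_le {m : FourierSymbol} {B : ℝ}
    (hB : ∀ ξ₁ ξ₂, ‖m.toFun ξ₁ ξ₂‖ ≤ B) (φ : L2Cyl L) :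
    ENNReal.ofReal L * ∑' k : ℤ, ∫⁻ ξ, ‖multiplierMode L m φ k ξ‖ₑ ^ 2 ≤
      ENNReal.ofReal B ^ 2 * ‖φ‖ₑ ^ 2 := by
  have hφ : ‖φ‖ₑ ^ 2 = ENNReal.ofReal L * ∑' k : ℤ, ∫⁻ x, ‖circleCoeff L k φ x‖ₑ ^ 2 := by
    rw [tsum_lintegral_sq_circleCoeff, ← eLpNorm_two_sq, Lp.enorm_def]
  rw [hφ, mul_left_comm, ← ENNReal.tsum_mul_left (a := ENNReal.ofReal B ^ 2)]
  refine mul_le_mul' le_rfl (ENNReal.tsum_le_tsum fun k => ?_)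
  have h1 : ∫⁻ x, ‖circleCoeff L k φ x‖ₑ ^ 2 = ∫⁻ ξ, ‖𝓕 (circleCoeff L k φ) ξ‖ₑ ^ 2 := by
    rw [← eLpNorm_two_sq, ← eLpNorm_two_sq, ← Lp.enorm_def, ← Lp.enorm_def, ← ofReal_norm,
      ← ofReal_norm, Lp.norm_fourier_eq]
  rw [h1, ← lintegral_const_mul' _ _ (by simp)]
  refine lintegral_mono fun ξ => ?_
  rw [multiplierMode, enorm_mul, mul_pow]
  gcongr
  rw [← ofReal_norm]
  exact ENNReal.ofReal_le_ofReal (hB _ _)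

variable {L}

theorem eq_zero_of_lt_abs {m : FourierSymbol} {ρ : ℝ} (hρ : 0 ≤ ρ)
    (hm : ∀ ξ₁ ξ₂, m.toFun ξ₁ ξ₂ ≠ 0 → ξ₁ ^ 2 + ξ₂ ^ 2 ≤ ρ ^ 2) {k : ℤ}
    (hk : k ∉ Finset.Icc (-⌈ρ * L⌉) ⌈ρ * L⌉) (ξ₁ : ℝ) : m.toFun ξ₁ (k / L) = 0 := by
  have hL : 0 < L := Fact.out
  by_contra h
  have h1 := hm _ _ h
  obtain ⟨h2, h3⟩ := abs_le.1 (abs_le_of_sq_le_sq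
    (by nlinarith [sq_nonneg ξ₁] : ((k : ℝ) / L) ^ 2 ≤ ρ ^ 2) hρ)
  rw [le_div_iff₀ hL] at h2
  rw [div_le_iff₀ hL] at h3
  refine hk (Finset.mem_Icc.2 ⟨?_, ?_⟩)
  · rw [← Int.floor_neg]
    exact Int.floor_le_iff.2 (by linarith)
  · exact Int.le_ceil_iff.2 (by linarith)

theorem integrable_multiplierMode {m : FourierSymbol} {ρ : ℝ} (hρ : 0 ≤ ρ)
    (hm : ∀ ξ₁ ξ₂, m.toFun ξ₁ ξ₂ ≠ 0 → ξ₁ ^ 2 + ξ₂ ^ 2 ≤ ρ ^ 2) (φ : L2Cyl L) (k : ℤ) :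
    Integrable (multiplierMode L m φ k) :=
  integrable_of_memLp_two_of_support (ρ := ρ) (memLp_multiplierMode L m φ k) fun ξ hξ =>
    abs_le_of_sq_le_sq (by nlinarith [hm _ _ (left_ne_zero_of_mul hξ), sq_nonneg ((k : ℝ) / L)]) hρ

theorem multiplierMode_eq_zero {m : FourierSymbol} {ρ : ℝ} (hρ : 0 ≤ ρ)
    (hm : ∀ ξ₁ ξ₂, m.toFun ξ₁ ξ₂ ≠ 0 → ξ₁ ^ 2 + ξ₂ ^ 2 ≤ ρ ^ 2) (φ : L2Cyl L) {k : ℤ}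
    (hk : k ∉ Finset.Icc (-⌈ρ * L⌉) ⌈ρ * L⌉) : multiplierMode L m φ k = 0 := by
  ext ξ
  rw [multiplierMode, eq_zero_of_lt_abs hρ hm hk, zero_mul]
  rfl

theorem hyperbolicFlow_ae_eq_evolution {m : FourierSymbol} {ρ : ℝ} (hρ : 0 ≤ ρ)
    (hm : ∀ ξ₁ ξ₂, m.toFun ξ₁ ξ₂ ≠ 0 → ξ₁ ^ 2 + ξ₂ ^ 2 ≤ ρ ^ 2) (φ : L2Cyl L) (t : ℝ) :
    hyperbolicFlow L t (fourierMultiplier L m φ) =ᵐ[volume]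
      evolution L (Finset.Icc (-⌈ρ * L⌉) ⌈ρ * L⌉) (multiplierMode L m φ) t :=
  hyperbolicFlow_fourierMultiplier_ae_eq (ρ := ρ) (fun _ hk => eq_zero_of_lt_abs hρ hm hk)
    (fun ξ₁ ξ₂ h => abs_le_of_sq_le_sq (by nlinarith [hm _ _ h, sq_nonneg ξ₂]) hρ) t φ

/-- The bilinear estimate for two multipliers with separated frequency supports. -/
theorem lintegral_sq_hyperbolicFlow_mul_le {m₁ m₂ : FourierSymbol} {B ρ₁ ρ M : ℝ}
    (hB₁ : ∀ ξ₁ ξ₂, ‖m₁.toFun ξ₁ ξ₂‖ ≤ B) (hB₂ : ∀ ξ₁ ξ₂, ‖m₂.toFun ξ₁ ξ₂‖ ≤ B)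
    (hL : 1 ≤ L) (hρ₁ : 0 ≤ ρ₁) (hρ : 1 ≤ ρ) (hM : 0 < M) (hρM : ρ ≤ 4 * M)
    (hm₁ : ∀ ξ₁ ξ₂, m₁.toFun ξ₁ ξ₂ ≠ 0 → ξ₁ ^ 2 + ξ₂ ^ 2 ≤ ρ₁ ^ 2)
    (hm₁' : ∀ ξ₁ ξ₂, m₁.toFun ξ₁ ξ₂ ≠ 0 → (8 * M) ^ 2 ≤ ξ₁ ^ 2 + ξ₂ ^ 2)
    (hm₂ : ∀ ξ₁ ξ₂, m₂.toFun ξ₁ ξ₂ ≠ 0 → ξ₁ ^ 2 + ξ₂ ^ 2 ≤ ρ ^ 2) (φ₁ φ₂ : L2Cyl L) :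
    ∫⁻ t in Set.Icc (0 : ℝ) 1, eLpNorm (fun x =>
        hyperbolicFlow L t (fourierMultiplier L m₁ φ₁) x *
          hyperbolicFlow L t (fourierMultiplier L m₂ φ₂) x) 2 volume ^ 2 ≤
      ENNReal.ofReal (Real.exp 1 * √Real.pi) *
        (∑' m : ℤ, ENNReal.ofReal (4 / (1 + (m : ℝ) ^ 2))) *
        ENNReal.ofReal (140 * (1 / L + ρ / M)) *
        ((ENNReal.ofReal B ^ 2 * ‖φ₁‖ₑ ^ 2) * (ENNReal.ofReal B ^ 2 * ‖φ₂‖ₑ ^ 2)) := by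
  have hρ0 : 0 ≤ ρ := by linarith
  have hL0 : 0 < L := by linarith
  have e : ∀ t, eLpNorm (fun x => hyperbolicFlow L t (fourierMultiplier L m₁ φ₁) x *
      hyperbolicFlow L t (fourierMultiplier L m₂ φ₂) x) 2 volume ^ 2 =
      ∫⁻ x, ‖evolution L (Finset.Icc (-⌈ρ₁ * L⌉) ⌈ρ₁ * L⌉) (multiplierMode L m₁ φ₁) t x *
        evolution L (Finset.Icc (-⌈ρ * L⌉) ⌈ρ * L⌉) (multiplierMode L m₂ φ₂) t x‖ₑ ^ 2 := by
    intro t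
    rw [eLpNorm_two_sq]
    refine lintegral_congr_ae ?_
    filter_upwards [hyperbolicFlow_ae_eq_evolution hρ₁ hm₁ φ₁ t,
      hyperbolicFlow_ae_eq_evolution hρ0 hm₂ φ₂ t] with x h1 h2
    rw [h1, h2]
  simp_rw [e]
  refine (lintegral_sq_evolution_mul_le (measurable_multiplierMode L m₁ φ₁)
    (measurable_multiplierMode L m₂ φ₂) (memLp_multiplierMode L m₁ φ₁)
    (memLp_multiplierMode L m₂ φ₂) (integrable_multiplierMode hρ₁ hm₁ φ₁)
    (integrable_multiplierMode hρ0 hm₂ φ₂) (fun _ hk => multiplierMode_eq_zero hρ₁ hm₁ φ₁ hk)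
    (fun _ hk => multiplierMode_eq_zero hρ0 hm₂ φ₂ hk) hL hρ hM hρM
    (fun l η h => hm₂ _ _ (left_ne_zero_of_mul h))
    (fun k ξ h => hm₁' _ _ (left_ne_zero_of_mul h))).trans ?_
  -- Each of the two data norms needs a factor `L` from Parseval, but the product supplied only one;
  -- the second is taken from `1 + ρL / M`, which leaves `1 / L + ρ / M`.
  have hs : ENNReal.ofReal (140 * (1 + ρ * L / M)) =
      ENNReal.ofReal (140 * (1 / L + ρ / M)) * ENNReal.ofReal L := by
    rw [← ENNReal.ofReal_mul (by positivity)]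
    congr 1
    field_simp
  rw [hs]
  refine le_trans (le_of_eq ?_) (mul_le_mul' le_rfl (mul_le_mul'
    (tsum_lintegral_sq_multiplierMode_le L hB₁ φ₁)
    (tsum_lintegral_sq_multiplierMode_le L hB₂ φ₂)))
  ring

end Localized

/-! ### Choice of constants and conclusion -/

theorem theorem1p3 (ψ : LittlewoodPaleyCutoff) :
    ∃ K C : ℝ, ∀ (L : ℝ) [Fact (0 < L)], 1 ≤ L →
      ∀ N₁ N₂ : ℕ, 1 ≤ N₂ → K * (N₂ : ℝ) ≤ (N₁ : ℝ) →
        ∀ φ₁ φ₂ : L2Cyl L,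
          spaceTimeL2Norm L (fun t x =>
            hyperbolicFlow L t (lpProj ψ L N₁ φ₁) x * hyperbolicFlow L t (lpProj ψ L N₂ φ₂) x) ≤
          ENNReal.ofReal
            (C * (1 / L + (N₂ : ℝ) / (N₁ : ℝ)) ^ (1 / 2 : ℝ) * ‖φ₁‖ * ‖φ₂‖) := by
  obtain ⟨B, hB⟩ := ψ.exists_symbol_bound
  have hr := ψ.r_pos
  set R := max ψ.R 1 with hR
  have hR1 : 1 ≤ R := le_max_right _ _
  set Q : ℝ≥0∞ := ENNReal.ofReal (Real.exp 1 * √Real.pi) *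
    (∑' m : ℤ, ENNReal.ofReal (4 / (1 + (m : ℝ) ^ 2))) *
    ENNReal.ofReal (140 * (1 + 8 * R / ψ.r)) * (ENNReal.ofReal B ^ 2 * ENNReal.ofReal B ^ 2) with hQ
  have hQtop : Q ≠ ∞ := by
    have := tsum_four_div_one_add_sq_ne_top
    finiteness
  -- The 2 in `K` forces `N₁ ≥ 2`, so that the high projection uses the annular cutoff; `2R / r`
  -- makes the outer radius `R N₂` at most half the inner radius `r N₁`. `Q` bounds the squared
  -- norm, hence the root.
  refine ⟨max 2 (2 * R / ψ.r), √Q.toReal, fun L _ hL N₁ N₂ hN₂ hK φ₁ φ₂ => ?_⟩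
  have hN₂' : (1 : ℝ) ≤ N₂ := by exact_mod_cast hN₂
  have hN₁' : (2 : ℝ) ≤ N₁ := by
    refine le_trans ?_ hK
    nlinarith [le_max_left 2 (2 * R / ψ.r)]
  have hN₁ : 2 ≤ N₁ := by exact_mod_cast hN₁'
  have hsep : 2 * (R * N₂) ≤ ψ.r * N₁ := by
    have h : 2 * R / ψ.r * N₂ ≤ N₁ := le_trans (by gcongr; exact le_max_right _ _) hK
    rw [div_mul_eq_mul_div, div_le_iff₀ hr] at h
    linarith
  set s : ℝ := 1 / L + (N₂ : ℝ) / N₁ with hs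
  have hs0 : 0 ≤ s := by positivity
  -- Here `8M = r N₁` is the inner radius of the high annulus, and `ρ ≤ 4M` is exactly `hsep`.
  -- Taking `R ≥ 1` ensures `ρ ≥ 1`.
  have hmain := lintegral_sq_hyperbolicFlow_mul_le (L := L) (M := ψ.r * N₁ / 8) (ρ := R * N₂)
    (ρ₁ := R * N₁) (hB N₁) (hB N₂) hL (by positivity) (one_le_mul_of_one_le_of_one_le hR1 hN₂')
    (by positivity) (by linarith) (fun _ _ h => ψ.symbol_support_le (by omega) h)
    (fun _ _ h => by
      rw [mul_div_cancel₀ _ (by norm_num : (8 : ℝ) ≠ 0)]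
      exact ψ.le_symbol_support hN₁ h)
    (fun _ _ h => ψ.symbol_support_le hN₂ h) φ₁ φ₂
  have hfac : 140 * (1 / L + R * N₂ / (ψ.r * N₁ / 8)) ≤ 140 * (1 + 8 * R / ψ.r) * s := by
    have e : R * N₂ / (ψ.r * N₁ / 8) = 8 * R / ψ.r * (N₂ / N₁) := by field_simp
    rw [e, hs]
    have h1 : 0 ≤ 8 * R / ψ.r * (1 / L) := by positivity
    have h2 : 0 ≤ (N₂ : ℝ) / N₁ := by positivity
    nlinarith
  have hbound : ∫⁻ t in Set.Icc (0 : ℝ) 1, eLpNorm (fun x =>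
      hyperbolicFlow L t (lpProj ψ L N₁ φ₁) x * hyperbolicFlow L t (lpProj ψ L N₂ φ₂) x) 2
        volume ^ 2 ≤ ENNReal.ofReal (Q.toReal * s * (‖φ₁‖ ^ 2 * ‖φ₂‖ ^ 2)) := by
    have e : ENNReal.ofReal (Q.toReal * s * (‖φ₁‖ ^ 2 * ‖φ₂‖ ^ 2)) =
        Q * ENNReal.ofReal s * (‖φ₁‖ₑ ^ 2 * ‖φ₂‖ₑ ^ 2) := by
      rw [ENNReal.ofReal_mul (by positivity), ENNReal.ofReal_mul (by positivity),
        ENNReal.ofReal_mul (by positivity), ENNReal.ofReal_toReal hQtop,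
        ENNReal.ofReal_pow (norm_nonneg _), ENNReal.ofReal_pow (norm_nonneg _), ofReal_norm,
        ofReal_norm]
    rw [e]
    refine hmain.trans ?_
    calc _ ≤ ENNReal.ofReal (Real.exp 1 * √Real.pi) *
          (∑' m : ℤ, ENNReal.ofReal (4 / (1 + (m : ℝ) ^ 2))) *
          (ENNReal.ofReal (140 * (1 + 8 * R / ψ.r)) * ENNReal.ofReal s) *
          ((ENNReal.ofReal B ^ 2 * ‖φ₁‖ₑ ^ 2) * (ENNReal.ofReal B ^ 2 * ‖φ₂‖ₑ ^ 2)) := by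
          rw [← ENNReal.ofReal_mul (by positivity)]
          gcongr
      _ = _ := by rw [hQ]; ring
  refine (ENNReal.rpow_le_rpow hbound (by norm_num)).trans (le_of_eq ?_)
  rw [ENNReal.ofReal_rpow_of_nonneg (by positivity) (by norm_num)]
  congr 1
  rw [Real.mul_rpow (by positivity) (by positivity), Real.mul_rpow (by positivity) hs0,
    Real.mul_rpow (by positivity) (by positivity), ← Real.sqrt_eq_rpow Q.toReal,
    ← Real.sqrt_eq_rpow (‖φ₁‖ ^ 2), ← Real.sqrt_eq_rpow (‖φ₂‖ ^ 2), Real.sqrt_sq (norm_nonneg _),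
    Real.sqrt_sq (norm_nonneg _)]
  ring
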